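/- Equip $\mathbb{C}P^2$ with the Fubini–Study symplectic form $\omega$ normalized so that complex projective lines have area $2$. Let $\Sigma=\{z_0^2+z_1^2+z_2^2=0\}\subset\mathbb{C}P^2$, with normal bundle $\pi:N_\Sigma\to\Sigma$, and let $s=z_0^2+z_1^2+z_2^2$, regarded as a section of $\mathcal{O}(2)$ with the norm $\|s\|([z])=|z_0^2+z_1^2+z_2^2|/|z|^2$. A *standard symplectic disc bundle* modelled on $N_\Sigma$ is the open unit disc bundle $E_\Sigma=\{r<1\}\subset N_\Sigma$ for some smooth Hermitian metric on $N_\Sigma$ with radial coordinate $r$, with the symplectic form given off the zero section by $\omega_0=\pi^*\omega|_\Sigma+d(r^2\alpha)$, where $\alpha$ is a connection $1$-form on the complement of the zero section with $d\alpha=-\pi^*\omega|_\Sigma$, normalized to have integral $1$ over the circles around $0$ in the fibres. *Biran's disc bundle* of $\Sigma$ is such a bundle together with a symplectomorphism $F:(E_\Sigma,\omega_0)\to(\mathbb{C}P^2\setminus\mathbb{R}P^2,\omega)$ that is the identity on the zero section $\Sigma$ and maps the radii of the fibres to gradient lines of $-\log\|s\|^2$; its fibre at $x\in\Sigma$ is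 regarded as the subset $F(E_\Sigma|_x)$ of $\mathbb{C}P^2$. **Proposition.** Biran's disc bundle of $\Sigma$ exists. Let $a,b,c$ be real numbers, not all zero, and let $D_{a,b,c}\subset\mathbb{C}P^2$ be the projective line $az_0+bz_1+cz_2=0$. Then $D_{a,b,c}\cap\Sigma=\{x,\bar x\}$ for two distinct complex conjugate points $x,\bar x$. The set $D_{a,b,c}\setminus\mathbb{R}P^2$ is the disjoint union of the connected component of $x$ and that of $\bar x$, and complex conjugation maps the first onto the second. Each of the two components is an open disc of area $1$, holomorphically embedded up to its boundary, with boundary the circle $D_{a,b,c}\cap\mathbb{R}P^2$. For every choice of Biran's disc bundle (of metric, connection form and $F$ as above), these two components are exactly its fibres at $x$ and at $\bar x$, respectively. -/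

import Mathlib

open scoped LinearAlgebra.Projectivization Topology ContDiff Matrix

noncomputable section

namespace BiranQuadric

/-! ### The complex projective plane -/

/-- The space `ℂ³` of homogeneous coordinates. -/
abbrev C3 : Type := Fin 3 → ℂ

/-- The complex projective plane. -/
abbrev CP2 : Type := ℙ ℂ C3

/-- The quotient topology of `ℂ³ \ {0} → ℂP²`. -/
instance : TopologicalSpace CP2 :=
  TopologicalSpace.coinduced (Projectivization.mk' ℂ : {v : C3 // v ≠ 0} → CP2) inferInstance

/-- `w` is a vector of homogeneous coordinates of the point `p`, that is `p = [w₀ : w₁ : w₂]`. -/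
def Represents (w : C3) (p : CP2) : Prop := w ≠ 0 ∧ w ∈ p.submodule

/-- Complex conjugation `[z₀ : z₁ : z₂] ↦ [z̄₀ : z̄₁ : z̄₂]`. -/
def conj : CP2 → CP2 :=
  Projectivization.map (starLinearEquiv ℂ (A := C3)).toLinearMap
    (starLinearEquiv ℂ (A := C3)).injective

/-- The real projective plane inside the complex one. -/
def RP2 : Set CP2 :=
  {p | ∃ v : Fin 3 → ℝ, v ≠ 0 ∧ (fun i => (v i : ℂ)) ∈ p.submodule}

/-- The quadric `z₀² + z₁² + z₂² = 0`. -/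
def quadric : Set CP2 := {p | ∀ z ∈ p.submodule, z 0 ^ 2 + z 1 ^ 2 + z 2 ^ 2 = 0}

/-- The projective line `a z₀ + b z₁ + c z₂ = 0`, for real `a`, `b`, `c`. -/
def realLine (a b c : ℝ) : Set CP2 :=
  {p | ∀ z ∈ p.submodule, (a : ℂ) * z 0 + (b : ℂ) * z 1 + (c : ℂ) * z 2 = 0}

/-! ### The Fubini–Study structure

Forms on `ℂP²` are written in homogeneous coordinates, that is, they are pulled back to
`ℂ³ \ {0}`. -/

/-- The standard Hermitian product of `ℂ³`, conjugate linear in the first variable. -/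
def herm (u v : C3) : ℂ := star u ⬝ᵥ v

/-- The square of the Hermitian norm of `ℂ³`. -/
def normSq (w : C3) : ℝ := (herm w w).re

/-- The Fubini–Study Hermitian form at `[w]`, pulled back to `ℂ³ \ {0}`. -/
def fsHerm (w u v : C3) : ℂ :=
  (herm u v * (normSq w : ℂ) - herm u w * herm w v) / (normSq w : ℂ) ^ 2

/-- The Fubini–Study symplectic form, pulled back to `ℂ³ \ {0}` and normalized so that complex
projective lines have area `2`. -/
def fsForm (w u v : C3) : ℝ := 2 / Real.pi * (fsHerm w u v).im

/-- The Riemannian metric that belongs to `fsForm` and to the complex structure. -/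
def fsMetric (w u v : C3) : ℝ := 2 / Real.pi * (fsHerm w u v).re

/-- The function `-log ‖s‖²`, pulled back to `ℂ³ \ {0}`, where `s = z₀² + z₁² + z₂²` is the
section of `𝒪(2)` that cuts out the quadric and `‖·‖` is the norm of `𝒪(2)` induced by the
Hermitian product of `ℂ³`. -/
def potential (w : C3) : ℝ := -Real.log (‖w ⬝ᵥ w‖ ^ 2 / normSq w ^ 2)

/-- `S` is an open disc in `ℂP²`, holomorphically embedded up to its boundary, which is the
circle `C`, and `S` has area `A` for the Fubini–Study form. Here `g` is the embedding of a
neighbourhood `U` of the closed unit disc and `f` is its lift to homogeneous coordinates. -/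
def IsDisc (S C : Set CP2) (A : ℝ) : Prop :=
  ∃ (U : Set ℂ) (g : ℂ → CP2) (f : ℂ → C3),
    IsOpen U ∧ Metric.closedBall (0 : ℂ) 1 ⊆ U ∧
    DifferentiableOn ℂ f U ∧
    (∀ ζ ∈ U, Represents (f ζ) (g ζ)) ∧
    Set.InjOn g (Metric.closedBall 0 1) ∧
    (∀ ζ ∈ Metric.closedBall (0 : ℂ) 1, deriv f ζ ∉ (g ζ).submodule) ∧
    g '' Metric.ball 0 1 = S ∧
    g '' Metric.sphere 0 1 = C ∧
    ∫ ζ in Metric.ball (0 : ℂ) 1, fsForm (f ζ) (deriv f ζ) (Complex.I • deriv f ζ) = A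

/-! ### The normal bundle of the quadric -/

/-- For `x = [z]` in the quadric, the plane `{w | z₀ w₀ + z₁ w₁ + z₂ w₂ = 0}` of `ℂ³` over the
projective tangent line of the quadric at `x`. -/
def tangentPlane (x : CP2) : Submodule ℂ C3 where
  carrier := {w | ∀ z ∈ x.submodule, z ⬝ᵥ w = 0}
  add_mem' := by
    intro u v hu hv z hz
    rw [dotProduct_add, hu z hz, hv z hz, add_zero]
  zero_mem' := by
    intro z _
    exact dotProduct_zero z
  smul_mem' := by
    intro c u hu z hz
    rw [dotProduct_smul, hu z hz, smul_zero]

/-- The normal space of the quadric at its point `x`. If `ℓ ⊆ ℂ³` is the line `x`, then the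
tangent space of `ℂP²` at `x` is `Hom(ℓ, ℂ³ / ℓ)`, that of the quadric is
`Hom(ℓ, tangentPlane x / ℓ)`, and the quotient of the two is `Hom(ℓ, ℂ³ / tangentPlane x)`. -/
abbrev NormalSpace (x : CP2) : Type := x.submodule →ₗ[ℂ] (C3 ⧸ tangentPlane x)

/-- The total space of the normal bundle of the quadric. -/
abbrev NormalBundle : Type := Σ x : quadric, NormalSpace x.1

/-- Homogeneous coordinates on the normal bundle: the point `e = (x, ν)` has the coordinates
`(z, τ) ∈ ℂ³ × ℂ` if `x = [z]` and if the linear map `ν` sends `z` to the class of `τ z̄`. (The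
vector `z̄` spans the orthogonal complement of `tangentPlane x`.) The coordinates of `e` are unique
up to `(z, τ) ↦ (l z, (l / l̄) τ)` with `l ∈ ℂ \ {0}`. -/
def HasCoords (e : NormalBundle) (y : C3 × ℂ) : Prop :=
  y.1 ≠ 0 ∧ ∃ h : y.1 ∈ e.1.1.submodule, e.2 ⟨y.1, h⟩ = Submodule.Quotient.mk (y.2 • star y.1)

/-- The set of all homogeneous coordinates of points of the normal bundle. It is a complex
submanifold of an open set of `ℂ³ × ℂ`. -/
def cone : Set (C3 × ℂ) := {y | y.1 ≠ 0 ∧ y.1 ⬝ᵥ y.1 = 0}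

/-- The tangent space of `cone` at its point `y`. -/
def coneTangent (y : C3 × ℂ) : Set (C3 × ℂ) := {v | y.1 ⬝ᵥ v.1 = 0}

/-- The change `(z, τ) ↦ (l z, (l / l̄) τ)` of homogeneous coordinates; it is real linear, so it
acts by the same formula on tangent vectors. -/
def rescale (l : ℂ) (y : C3 × ℂ) : C3 × ℂ := (l • y.1, l / star l * y.2)

/-- A Hermitian metric on the normal bundle of the quadric, given by its norm. The norm of the
point with the homogeneous coordinates `(z, τ)` is `weight z * |τ|`, and the metric is smooth. -/
structure HermitianMetric where
  norm : NormalBundle → ℝ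
  weight : C3 → ℝ
  norm_eq : ∀ e y, HasCoords e y → norm e = weight y.1 * ‖y.2‖
  norm_smul : ∀ (x : quadric) (ν : NormalSpace x.1) (c : ℂ), norm ⟨x, c • ν⟩ = ‖c‖ * norm ⟨x, ν⟩
  norm_pos : ∀ (x : quadric) (ν : NormalSpace x.1), ν ≠ 0 → 0 < norm ⟨x, ν⟩
  smooth : ContDiffOn ℝ ∞ weight {z | z ≠ 0}

/-- The radial coordinate `r` of the normal bundle, in homogeneous coordinates. -/
def HermitianMetric.radius (h : HermitianMetric) (y : C3 × ℂ) : ℝ := h.weight y.1 * ‖y.2‖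

/-- A connection `1`-form `α` with `dα = -π^* ω` on the normal bundle of the quadric without its
zero section. In homogeneous coordinates it is the restriction to `{τ ≠ 0} ⊆ cone` of a smooth
`1`-form. The fields `rescale_inv` and `vertical` say that this restriction is pulled back from the
normal bundle; `fibre_inv`, `radial` and `angular` say that `α` is a connection form: it is
invariant under the action of `ℂ \ {0}` on the fibres, vanishes in the radial direction, and has
integral `1` over the circles around `0` in the fibres. -/
structure ConnectionForm where
  form : C3 × ℂ → (C3 × ℂ) [⋀^Fin 1]→L[ℝ] ℝ
  smooth : ContDiffOn ℝ ∞ form {y | y.1 ≠ 0 ∧ y.2 ≠ 0}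
  rescale_inv : ∀ y ∈ cone, y.2 ≠ 0 → ∀ v ∈ coneTangent y, ∀ l : ℂ, l ≠ 0 →
    form (rescale l y) ![rescale l v] = form y ![v]
  vertical : ∀ y ∈ cone, y.2 ≠ 0 → ∀ c : ℂ, form y ![(c • y.1, (c - star c) * y.2)] = 0
  fibre_inv : ∀ y ∈ cone, y.2 ≠ 0 → ∀ v ∈ coneTangent y, ∀ c : ℂ, c ≠ 0 →
    form (y.1, c * y.2) ![(v.1, c * v.2)] = form y ![v]
  radial : ∀ y ∈ cone, y.2 ≠ 0 → form y ![(0, y.2)] = 0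
  angular : ∀ y ∈ cone, y.2 ≠ 0 → form y ![(0, Complex.I * y.2)] = 1 / (2 * Real.pi)
  curvature : ∀ y ∈ cone, y.2 ≠ 0 → ∀ v ∈ coneTangent y, ∀ w ∈ coneTangent y,
    extDeriv form y ![v, w] = -fsForm y.1 v.1 w.1

/-- The form `ω₀ = π^* ω + d(r² α)` of the standard symplectic disc bundle, away from the zero
section, in homogeneous coordinates. -/
def standardForm (h : HermitianMetric) (α : ConnectionForm) (y v w : C3 × ℂ) : ℝ :=
  fsForm y.1 v.1 w.1 + extDeriv (fun y' => h.radius y' ^ 2 • α.form y') y ![v, w]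

/-- `G` is a lift of `F` to homogeneous coordinates near `y`, smooth at `y`. -/
def IsLiftAt (F : NormalBundle → CP2) (G : C3 × ℂ → C3) (y : C3 × ℂ) : Prop :=
  ContDiffAt ℝ ∞ G y ∧ ∀ᶠ y' in 𝓝 y, ∀ e, HasCoords e y' → Represents (G y') (F e)

/-- Biran's disc bundle of the quadric: a standard symplectic disc bundle
`E = {r < 1}`, `ω₀ = π^* ω + d(r² α)`, modelled on the normal bundle, together with a
symplectomorphism from `E` onto the complement of `RP²` in `ℂP²` that is the identity on the
quadric and maps the radii of the fibres of `E` to gradient lines of `-log ‖s‖²`. -/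
structure BiranDiscBundle where
  metric : HermitianMetric
  connection : ConnectionForm
  toFun : NormalBundle → CP2
  zero_section : ∀ x : quadric, toFun ⟨x, 0⟩ = x.1
  injOn : Set.InjOn toFun {e | metric.norm e < 1}
  image_eq : toFun '' {e | metric.norm e < 1} = RP2ᶜ
  smooth : ∀ e y, metric.norm e < 1 → HasCoords e y → ∃ G, IsLiftAt toFun G y
  smooth_inv : ∀ w₀ p₀, Represents w₀ p₀ → p₀ ∉ RP2 → ∃ H : C3 → C3 × ℂ, ContDiffAt ℝ ∞ H w₀ ∧
    ∀ᶠ w in 𝓝 w₀, ∀ p, Represents w p →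
      ∃ e, metric.norm e < 1 ∧ toFun e = p ∧ HasCoords e (H w)
  symplectic : ∀ e y G, metric.norm e < 1 → HasCoords e y → y.2 ≠ 0 → IsLiftAt toFun G y →
    ∀ v ∈ coneTangent y, ∀ w ∈ coneTangent y,
      fsForm (G y) (fderiv ℝ G y v) (fderiv ℝ G y w) = standardForm metric connection y v w
  gradient : ∀ e y G, metric.norm e < 1 → HasCoords e y → y.2 ≠ 0 → IsLiftAt toFun G y →
    ∃ k : ℝ, ∀ u : C3,
      fsMetric (G y) (fderiv ℝ G y (0, y.2)) u = k * fderiv ℝ potential (G y) u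

/-- The fibre over the point `x` of the quadric, as a subset of `ℂP²`. -/
def BiranDiscBundle.fibre (B : BiranDiscBundle) (x : CP2) : Set CP2 :=
  B.toFun '' {e | e.1.1 = x ∧ B.metric.norm e < 1}

/-- The part of the line that contains `x`, after the line is cut along `RP²`: the connected
component of `x` in the line without its real points. -/
def side (a b c : ℝ) (x : CP2) : Set CP2 := connectedComponentIn (realLine a b c \ RP2) x

end BiranQuadric

end

noncomputable section

namespace BiranQuadric

/-! ### Hermitian algebra of `ℂ³` -/

/-! For w = u + iv with u, v real, `planeNormal w` is u × v. Multiplying w by l multiplies it by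
|l|², and it vanishes exactly when [w] is real. So its direction, `unitNormal`, is a well-defined
map from CP² \ RP² to the sphere: the oriented real plane of a non-real point.

If z is isotropic, then z and z̄ span the complex plane orthogonal to `planeNormal z`, and αz + βz̄
has the normal (|α|² - |β|²) `planeNormal z`. Hence the points with the same unit normal as [z] are
the [z + ζz̄] with |ζ| < 1, which form `disc z` (`Represents.mem_disc`). The discs of different
points of the quadric are disjoint (`eq_of_disc_inter`). A real line through [z] also contains [z̄],
and the sign of |α|² - |β|² cuts it into `disc z`, `disc z̄` and the real circle |α| = |β|.

Fibres: the potential is stationary in the complex direction of `planeNormal w`, so its gradient is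
orthogonal to that direction, and `unitNormal` is constant along gradient lines
(`hasDerivAt_unitNormal`). Following the radii from the zero section puts the fibre over [z] inside
`disc z`. Since the fibres exhaust CP² \ RP² and the discs are disjoint, the inclusion is an
equality (`fibre_eq`).

Existence: the bundle is written down as (z, τ) ↦ [√(2 - |τ|²) z + τ z̄]. The root is dictated by
area: the part |τ| < r of a fibre must have area r², while |ζ| < ρ has area 2ρ²/(1 + ρ²), which
forces ζ = τ/√(2 - |τ|²) up to phase. The connection form is explicit, the inverse comes from a
quadratic equation, and `IsLiftAt.exists_scale` carries the conditions from this lift to every other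
one. -/

lemma herm_apply (u v : C3) :
    herm u v = star (u 0) * v 0 + star (u 1) * v 1 + star (u 2) * v 2 := by
  simp [herm, dotProduct, Fin.sum_univ_three]

lemma dot_apply (u v : C3) : u ⬝ᵥ v = u 0 * v 0 + u 1 * v 1 + u 2 * v 2 := by
  simp [dotProduct, Fin.sum_univ_three]

lemma normSq_apply (w : C3) : normSq w = (w 0).re ^ 2 + (w 0).im ^ 2 + (w 1).re ^ 2
    + (w 1).im ^ 2 + (w 2).re ^ 2 + (w 2).im ^ 2 := by
  simp [normSq, herm_apply]; ring

lemma herm_self (w : C3) : herm w w = (normSq w : ℂ) := by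
  apply Complex.ext
  · simp [normSq]
  · simp [herm_apply]; ring

lemma star_herm (u v : C3) : star (herm u v) = herm v u := by
  simp [herm_apply]; ring

lemma herm_star_star (u v : C3) : herm (star u) (star v) = herm v u := by
  simp [herm_apply]; ring

lemma herm_star_left (u v : C3) : herm (star u) v = u ⬝ᵥ v := by
  simp [herm_apply, dot_apply]

lemma herm_star_right (u v : C3) : herm u (star v) = star (u ⬝ᵥ v) := by
  simp [herm_apply, dot_apply]

lemma herm_add_left (u v w : C3) : herm (u + v) w = herm u w + herm v w := by
  simp [herm]

lemma herm_add_right (u v w : C3) : herm u (v + w) = herm u v + herm u w := by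
  simp [herm]

lemma herm_smul_left (c : ℂ) (u v : C3) : herm (c • u) v = star c * herm u v := by
  simp [herm]

lemma herm_smul_right (c : ℂ) (u v : C3) : herm u (c • v) = c * herm u v := by
  simp [herm]

lemma normSq_pos {w : C3} (hw : w ≠ 0) : 0 < normSq w := by
  have h0 : 0 ≤ normSq w := by rw [normSq_apply]; positivity
  refine lt_of_le_of_ne h0 fun h => hw ?_
  rw [normSq_apply] at h
  have h1 : ∀ i, w i = 0 := by
    intro i
    apply Complex.ext <;> fin_cases i <;> simp <;> nlinarith [sq_nonneg (w 0).re,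
      sq_nonneg (w 0).im, sq_nonneg (w 1).re, sq_nonneg (w 1).im, sq_nonneg (w 2).re,
      sq_nonneg (w 2).im]
  exact funext h1

lemma normSq_ne_zero {w : C3} (hw : w ≠ 0) : (normSq w : ℂ) ≠ 0 := by
  exact_mod_cast (normSq_pos hw).ne'

lemma normSq_smul (c : ℂ) (w : C3) : normSq (c • w) = ‖c‖ ^ 2 * normSq w := by
  have h : (normSq (c • w) : ℂ) = ((‖c‖ ^ 2 * normSq w : ℝ) : ℂ) := by
    rw [← herm_self, herm_smul_left, herm_smul_right, herm_self, ← mul_assoc]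
    have := Complex.conj_mul' c
    push_cast
    rw [← this]; rfl
  exact_mod_cast h

lemma normSq_star (w : C3) : normSq (star w) = normSq w := by
  simp [normSq, herm_star_star]

lemma star_dot_star (u v : C3) : star u ⬝ᵥ star v = star (u ⬝ᵥ v) := by
  simp [dot_apply]

/-- The Fubini–Study Hermitian form does not depend on the lift of the tangent vectors. -/
lemma fsHerm_change {w : C3} (hw : w ≠ 0) {l : ℂ} (hl : l ≠ 0) (u v : C3) (a b : ℂ) :
    fsHerm (l • w) (l • u + a • w) (l • v + b • w) = fsHerm w u v := by
  have hN := normSq_ne_zero hw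
  have hl' : star l ≠ 0 := star_ne_zero.mpr hl
  have hN' : (normSq (l • w) : ℂ) = star l * l * normSq w := by
    rw [← herm_self, herm_smul_left, herm_smul_right, herm_self]; ring
  unfold fsHerm
  rw [hN']
  simp only [herm_add_left, herm_add_right, herm_smul_left, herm_smul_right, herm_self]
  field_simp
  ring

/-! ### Homogeneous coordinates -/

lemma represents_iff {w : C3} {p : CP2} :
    Represents w p ↔ ∃ hw : w ≠ 0, Projectivization.mk ℂ w hw = p := by
  constructor
  · rintro ⟨hw, h⟩
    refine ⟨hw, ?_⟩
    rw [← p.mk_rep] at h ⊢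
    rw [Projectivization.submodule_mk, Submodule.mem_span_singleton] at h
    rw [Projectivization.mk_eq_mk_iff']
    exact h
  · rintro ⟨hw, rfl⟩
    exact ⟨hw, by rw [Projectivization.submodule_mk]; exact Submodule.mem_span_singleton_self w⟩

lemma represents_mk {w : C3} (hw : w ≠ 0) : Represents w (Projectivization.mk ℂ w hw) :=
  represents_iff.mpr ⟨hw, rfl⟩

lemma exists_represents (p : CP2) : ∃ w, Represents w p :=
  ⟨p.rep, represents_iff.mpr ⟨p.rep_nonzero, p.mk_rep⟩⟩

lemma Represents.submodule_eq {w : C3} {p : CP2} (h : Represents w p) :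
    p.submodule = Submodule.span ℂ {w} := by
  obtain ⟨hw, rfl⟩ := represents_iff.mp h
  rw [Projectivization.submodule_mk]

lemma Represents.mem_iff {w v : C3} {p : CP2} (h : Represents w p) :
    v ∈ p.submodule ↔ ∃ l : ℂ, l • w = v := by
  rw [h.submodule_eq, Submodule.mem_span_singleton]

lemma Represents.exists_smul {w v : C3} {p : CP2} (h : Represents w p) (h' : Represents v p) :
    ∃ l : ℂ, l ≠ 0 ∧ v = l • w := by
  obtain ⟨l, hl⟩ := h.mem_iff.mp h'.2
  refine ⟨l, ?_, hl.symm⟩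
  rintro rfl
  exact h'.1 (by rw [← hl, zero_smul])

lemma Represents.smul {w : C3} {p : CP2} (h : Represents w p) {l : ℂ} (hl : l ≠ 0) :
    Represents (l • w) p :=
  ⟨smul_ne_zero hl h.1, p.submodule.smul_mem l h.2⟩

lemma Represents.unique {w : C3} {p q : CP2} (h : Represents w p) (h' : Represents w q) :
    p = q := by
  obtain ⟨_, rfl⟩ := represents_iff.mp h
  obtain ⟨_, rfl⟩ := represents_iff.mp h'
  rfl

lemma Represents.conj {w : C3} {p : CP2} (h : Represents w p) :
    Represents (star w) (conj p) := by
  obtain ⟨hw, rfl⟩ := represents_iff.mp h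
  refine represents_iff.mpr ⟨star_ne_zero.mpr hw, ?_⟩
  rw [BiranQuadric.conj, Projectivization.map_mk]
  rfl

lemma Represents.mem_realLine {w : C3} {p : CP2} (h : Represents w p) (a b c : ℝ) :
    p ∈ realLine a b c ↔ (a : ℂ) * w 0 + b * w 1 + c * w 2 = 0 := by
  constructor
  · exact fun hp => hp w h.2
  · intro hp z hz
    obtain ⟨l, rfl⟩ := h.mem_iff.mp hz
    simp only [Pi.smul_apply, smul_eq_mul]
    linear_combination l * hp

lemma Represents.mem_quadric {w : C3} {p : CP2} (h : Represents w p) :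
    p ∈ quadric ↔ w ⬝ᵥ w = 0 := by
  rw [dot_apply]
  constructor
  · exact fun hp => by linear_combination hp w h.2
  · intro hp z hz
    obtain ⟨l, rfl⟩ := h.mem_iff.mp hz
    simp only [Pi.smul_apply, smul_eq_mul]
    linear_combination l ^ 2 * hp

/-! ### The oriented real plane of a non-real point -/

/-- The cross product of the real and the imaginary part of a vector of `ℂ³`. -/
def planeNormal (w : C3) : Fin 3 → ℝ :=
  ![(star (w 1) * w 2).im, (star (w 2) * w 0).im, (star (w 0) * w 1).im]

lemma planeNormal_smul (l : ℂ) (w : C3) :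
    planeNormal (l • w) = ‖l‖ ^ 2 • planeNormal w := by
  ext i
  rw [Complex.sq_norm, Complex.normSq_apply]
  fin_cases i <;> simp [planeNormal] <;> ring

lemma planeNormal_star (w : C3) : planeNormal (star w) = -planeNormal w := by
  ext i
  fin_cases i <;> simp [planeNormal] <;> ring

/-- The real and imaginary parts of αz + βz̄ are real combinations of those of z, and |α|² - |β|² is
the determinant of this change. -/
lemma planeNormal_combination (z : C3) (α β : ℂ) :
    planeNormal (α • z + β • star z) = (‖α‖ ^ 2 - ‖β‖ ^ 2) • planeNormal z := by
  ext i
  rw [Complex.sq_norm, Complex.sq_norm, Complex.normSq_apply, Complex.normSq_apply]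
  fin_cases i <;> simp [planeNormal] <;> ring

/-- Lagrange's identity |u × v|² = |u|²|v|² - (u·v)², rewritten for w = u + iv. It shows that
nonzero isotropic vectors have a nonzero normal. -/
lemma four_mul_planeNormal_sq (w : C3) :
    4 * (planeNormal w ⬝ᵥ planeNormal w) = normSq w ^ 2 - ‖w ⬝ᵥ w‖ ^ 2 := by
  rw [Complex.sq_norm, Complex.normSq_apply, dot_apply, normSq_apply]
  simp [planeNormal, dotProduct, Fin.sum_univ_three]
  ring

lemma planeNormal_dot_self (w : C3) :
    (planeNormal w 0 : ℂ) * w 0 + planeNormal w 1 * w 1 + planeNormal w 2 * w 2 = 0 := by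
  apply Complex.ext <;> simp [planeNormal] <;> ring

lemma planeNormal_ne_zero {z : C3} (hz : z ≠ 0) (hzz : z ⬝ᵥ z = 0) : planeNormal z ≠ 0 := by
  intro h
  have h1 := four_mul_planeNormal_sq z
  rw [h, hzz] at h1
  have := normSq_pos hz
  simp at h1
  nlinarith

lemma Represents.mem_RP2 {w : C3} {p : CP2} (h : Represents w p) :
    p ∈ RP2 ↔ planeNormal w = 0 := by
  constructor
  · rintro ⟨v, hv, hvp⟩
    obtain ⟨l, hl⟩ := h.mem_iff.mp hvp
    have hl0 : l ≠ 0 := by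
      rintro rfl
      apply hv
      ext i
      have := congrFun hl i
      simpa using this.symm
    have h1 := planeNormal_smul l w
    rw [hl] at h1
    have h2 : planeNormal (fun i => (v i : ℂ)) = 0 := by
      ext i
      fin_cases i <;> simp [planeNormal]
    rw [h2] at h1
    have h3 : ‖l‖ ^ 2 ≠ 0 := pow_ne_zero 2 (norm_ne_zero_iff.mpr hl0)
    exact (smul_eq_zero.mp h1.symm).resolve_left h3
  · intro hn
    obtain ⟨j, hj⟩ : ∃ j, w j ≠ 0 := by
      by_contra! hc
      exact h.1 (funext hc)
    -- Up to sign, these imaginary parts are components of the normal or zero, so multiplication by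
    -- the conjugate of `w j` makes all coordinates real.
    have him : ∀ i, (star (w j) * w i).im = 0 := by
      have h0 := congrFun hn 0
      have h1 := congrFun hn 1
      have h2 := congrFun hn 2
      simp [planeNormal] at h0 h1 h2
      intro i
      fin_cases j <;> fin_cases i <;> simp <;> linarith
    refine ⟨fun i => (star (w j) * w i).re, ?_, ?_⟩
    · intro hc
      have := congrFun hc j
      have h5 : star (w j) * w j = 0 := Complex.ext (by simpa using this) (by simpa using him j)
      simp [hj] at h5
    · have : (fun i => (((star (w j) * w i).re : ℝ) : ℂ)) = star (w j) • w := by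
        ext i
        apply Complex.ext
        · simp
        · have := him i
          simp only [Pi.smul_apply, smul_eq_mul, Complex.ofReal_im]
          exact this.symm
      rw [this]
      exact p.submodule.smul_mem _ h.2

lemma ofReal_planeNormal (z : C3) :
    (planeNormal z 0 : ℂ) = (star (z 1) * z 2 - star (z 2) * z 1) / (2 * Complex.I) ∧
    (planeNormal z 1 : ℂ) = (star (z 2) * z 0 - star (z 0) * z 2) / (2 * Complex.I) ∧
    (planeNormal z 2 : ℂ) = (star (z 0) * z 1 - star (z 1) * z 0) / (2 * Complex.I) := by
  refine ⟨?_, ?_, ?_⟩ <;> rw [eq_div_iff (by simp)] <;> apply Complex.ext <;>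
    simp [planeNormal] <;> ring

/-- A non-real z, its conjugate and its normal n form a basis of ℂ³. -/
lemma eq_zero_of_orthogonal {z u : C3} (hz : planeNormal z ≠ 0) (h1 : z ⬝ᵥ u = 0)
    (h2 : star z ⬝ᵥ u = 0)
    (h3 : (planeNormal z 0 : ℂ) * u 0 + planeNormal z 1 * u 1 + planeNormal z 2 * u 2 = 0) :
    u = 0 := by
  obtain ⟨e0, e1, e2⟩ := ofReal_planeNormal z
  rw [dot_apply] at h1 h2
  simp only [Pi.star_apply] at h2
  -- `c0`, `c1`, `c2` are the components of u × n. As n = (z̄ × z)/2i, they vanish by the expansion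
  -- of the double cross product. With n·u = 0 this gives (n·n) u = 0.
  have c0 : u 1 * (planeNormal z 2 : ℂ) - u 2 * planeNormal z 1 = 0 := by
    rw [e1, e2]; field_simp; linear_combination star (z 0) * h1 - z 0 * h2
  have c1 : u 2 * (planeNormal z 0 : ℂ) - u 0 * planeNormal z 2 = 0 := by
    rw [e0, e2]; field_simp; linear_combination star (z 1) * h1 - z 1 * h2
  have c2 : u 0 * (planeNormal z 1 : ℂ) - u 1 * planeNormal z 0 = 0 := by
    rw [e0, e1]; field_simp; linear_combination star (z 2) * h1 - z 2 * h2
  have hD : ((planeNormal z ⬝ᵥ planeNormal z : ℝ) : ℂ) ≠ 0 := by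
    rw [Ne, Complex.ofReal_eq_zero, dotProduct_self_eq_zero]
    exact hz
  have hD' : ((planeNormal z ⬝ᵥ planeNormal z : ℝ) : ℂ) = (planeNormal z 0 : ℂ) ^ 2
      + (planeNormal z 1 : ℂ) ^ 2 + (planeNormal z 2 : ℂ) ^ 2 := by
    simp [dotProduct, Fin.sum_univ_three]; ring
  rw [hD'] at hD
  ext i
  apply (mul_eq_zero.mp (_ : _ * _ = (0 : ℂ))).resolve_left hD
  fin_cases i
  · change _ * u 0 = 0
    linear_combination (planeNormal z 0 : ℂ) * h3 + planeNormal z 1 * c2 - planeNormal z 2 * c1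
  · change _ * u 1 = 0
    linear_combination (planeNormal z 1 : ℂ) * h3 - planeNormal z 0 * c2 + planeNormal z 2 * c0
  · change _ * u 2 = 0
    linear_combination (planeNormal z 2 : ℂ) * h3 + planeNormal z 0 * c1 - planeNormal z 1 * c0

/-- The isotropic vectors `z` and `z̄` span the plane orthogonal to `planeNormal z`. -/
lemma exists_combination {z w : C3} (hz : z ≠ 0) (hzz : z ⬝ᵥ z = 0)
    (hw : (planeNormal z 0 : ℂ) * w 0 + planeNormal z 1 * w 1 + planeNormal z 2 * w 2 = 0) :
    ∃ α β : ℂ, w = α • z + β • star z := by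
  have hN := normSq_ne_zero hz
  refine ⟨herm z w / normSq z, (z ⬝ᵥ w) / normSq z, ?_⟩
  rw [← sub_eq_zero]
  have e1 : z ⬝ᵥ star z = normSq z := by rw [← herm_self, herm, dotProduct_comm]
  have e2 : star z ⬝ᵥ z = normSq z := by rw [← herm_self, herm]
  have e3 : star z ⬝ᵥ star z = 0 := by rw [star_dot_star, hzz, star_zero]
  apply eq_zero_of_orthogonal (planeNormal_ne_zero hz hzz)
  · rw [dotProduct_sub, dotProduct_add, dotProduct_smul, dotProduct_smul, hzz, e1]
    simp only [smul_eq_mul]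
    field_simp
    ring
  · rw [dotProduct_sub, dotProduct_add, dotProduct_smul, dotProduct_smul, e2, e3]
    simp only [smul_eq_mul]
    field_simp
    rw [herm]; ring
  · have h1 := planeNormal_dot_self z
    have h2 := planeNormal_dot_self (star z)
    rw [planeNormal_star] at h2
    simp only [Pi.sub_apply, Pi.add_apply, Pi.smul_apply, smul_eq_mul, Pi.neg_apply,
      Complex.ofReal_neg] at h2 ⊢
    linear_combination hw - herm z w / normSq z * h1 + (z ⬝ᵥ w) / normSq z * h2

/-! ### The two halves of a real line -/

lemma herm_isotropic_combination {z : C3} (hzz : z ⬝ᵥ z = 0) (α β : ℂ) :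
    herm z (α • z + β • star z) = α * normSq z := by
  rw [herm_add_right, herm_smul_right, herm_smul_right, herm_star_right, hzz, herm_self]
  simp

lemma herm_star_isotropic_combination {z : C3} (hzz : z ⬝ᵥ z = 0) (α β : ℂ) :
    herm (star z) (α • z + β • star z) = β * normSq z := by
  rw [herm_add_right, herm_smul_right, herm_smul_right, herm_star_left, hzz, herm_self,
    normSq_star]
  simp

lemma combination_ne_zero {z : C3} (hz : z ≠ 0) (hzz : z ⬝ᵥ z = 0) {α : ℂ} (hα : α ≠ 0)
    (β : ℂ) : α • z + β • star z ≠ 0 := by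
  intro h
  have h1 := herm_isotropic_combination hzz α β
  rw [h] at h1
  have h2 := mul_ne_zero hα (normSq_ne_zero hz)
  apply h2
  rw [← h1]
  simp [herm]

lemma add_smul_star_ne_zero {z : C3} (hz : z ≠ 0) (hzz : z ⬝ᵥ z = 0) (ζ : ℂ) :
    z + ζ • star z ≠ 0 := by
  simpa using combination_ne_zero hz hzz one_ne_zero ζ

/-- The points `[z + ζ z̄]` with `|ζ| < 1`. -/
def disc (z : C3) : Set CP2 := {p | ∃ ζ : ℂ, ‖ζ‖ < 1 ∧ Represents (z + ζ • star z) p}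

lemma star_isotropic {z : C3} (hzz : z ⬝ᵥ z = 0) : star z ⬝ᵥ star z = 0 := by
  rw [star_dot_star, hzz, star_zero]

/-- The normal alone recognizes the disc: a vector whose normal is a positive multiple of that of z
lies in the span of z and z̄, and |α|² - |β|² > 0 allows division by α, with ζ = β/α. -/
lemma Represents.mem_disc {z w : C3} {p : CP2} (hz : z ≠ 0) (hzz : z ⬝ᵥ z = 0)
    (h : Represents w p) :
    p ∈ disc z ↔ ∃ k : ℝ, 0 < k ∧ planeNormal w = k • planeNormal z := by
  constructor
  · rintro ⟨ζ, hζ, hp⟩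
    obtain ⟨l, hl, rfl⟩ := hp.exists_smul h
    refine ⟨‖l‖ ^ 2 * (1 - ‖ζ‖ ^ 2), ?_, ?_⟩
    · have h1 : 0 < ‖l‖ := norm_pos_iff.mpr hl
      have h2 : ‖ζ‖ ^ 2 < 1 := by
        have := norm_nonneg ζ
        nlinarith
      have h3 : 0 < 1 - ‖ζ‖ ^ 2 := by linarith
      positivity
    · have := planeNormal_combination z 1 ζ
      rw [one_smul, norm_one, one_pow] at this
      rw [planeNormal_smul, this, smul_smul]
  · rintro ⟨k, hk, hn⟩
    have h1 := planeNormal_dot_self w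
    rw [hn] at h1
    have hk' : (k : ℂ) ≠ 0 := by exact_mod_cast hk.ne'
    obtain ⟨α, β, rfl⟩ := exists_combination (w := w) hz hzz (by
      apply mul_left_cancel₀ hk'
      simp only [Pi.smul_apply, smul_eq_mul, Complex.ofReal_mul] at h1
      linear_combination h1)
    rw [planeNormal_combination] at hn
    have hk2 : ‖α‖ ^ 2 - ‖β‖ ^ 2 = k := smul_left_injective ℝ (planeNormal_ne_zero hz hzz) hn
    have hα : α ≠ 0 := by
      rintro rfl
      simp only [norm_zero] at hk2
      nlinarith [sq_nonneg ‖β‖]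
    refine ⟨β / α, ?_, ?_⟩
    · rw [norm_div, div_lt_one (norm_pos_iff.mpr hα)]
      nlinarith [norm_nonneg α, norm_nonneg β]
    · have := h.smul (inv_ne_zero hα)
      rwa [smul_add, smul_smul, smul_smul, inv_mul_cancel₀ hα, one_smul, ← div_eq_inv_mul] at this

lemma self_mem_disc {z : C3} {x : CP2} (hx : Represents z x) : x ∈ disc z :=
  ⟨0, by simp, by simpa using hx⟩

/-- A real linear form that kills z also kills z̄, so its coefficient vector is a multiple of their
common normal. -/
lemma planeNormal_real_proportional {z : C3} (hz : z ≠ 0) (hzz : z ⬝ᵥ z = 0) {a b c : ℝ}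
    (h0 : ¬(a = 0 ∧ b = 0 ∧ c = 0)) (hl : (a : ℂ) * z 0 + b * z 1 + c * z 2 = 0) :
    ∃ k : ℝ, k ≠ 0 ∧ a = k * planeNormal z 0 ∧ b = k * planeNormal z 1 ∧
      c = k * planeNormal z 2 := by
  set n := planeNormal z with hn
  have hn0 : n ≠ 0 := planeNormal_ne_zero hz hzz
  have hD : n 0 ^ 2 + n 1 ^ 2 + n 2 ^ 2 ≠ 0 := by
    have : n ⬝ᵥ n ≠ 0 := by rwa [Ne, dotProduct_self_eq_zero]
    intro h; apply this
    simp [dotProduct, Fin.sum_univ_three]; linarith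
  -- The coefficient of the orthogonal projection onto n; the remainder is then orthogonal to z, z̄
  -- and n.
  set k := (a * n 0 + b * n 1 + c * n 2) / (n 0 ^ 2 + n 1 ^ 2 + n 2 ^ 2) with hk
  have hkD : k * (n 0 ^ 2 + n 1 ^ 2 + n 2 ^ 2) = a * n 0 + b * n 1 + c * n 2 := by
    rw [hk]; field_simp
  have h1 := planeNormal_dot_self z
  rw [← hn] at h1
  have hu : (![(a - k * n 0 : ℂ), b - k * n 1, c - k * n 2] : C3) = 0 := by
    apply eq_zero_of_orthogonal (z := z) hn0
    · rw [dot_apply]; simp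
      linear_combination hl - (k : ℂ) * h1
    · rw [dot_apply]; simp
      have hl' := congrArg star hl
      have h1' := congrArg star h1
      simp at hl' h1'
      linear_combination hl' - (k : ℂ) * h1'
    · rw [← hn]; simp
      have : (k : ℂ) * (n 0 ^ 2 + n 1 ^ 2 + n 2 ^ 2) = a * n 0 + b * n 1 + c * n 2 := by
        exact_mod_cast hkD
      linear_combination -this
  have e0 : (a - k * n 0 : ℂ) = 0 := by simpa using congrFun hu 0
  have e1 : (b - k * n 1 : ℂ) = 0 := by simpa using congrFun hu 1
  have e2 : (c - k * n 2 : ℂ) = 0 := by simpa using congrFun hu 2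
  have e0' : a - k * n 0 = 0 := by exact_mod_cast e0
  have e1' : b - k * n 1 = 0 := by exact_mod_cast e1
  have e2' : c - k * n 2 = 0 := by exact_mod_cast e2
  refine ⟨k, ?_, by linarith, by linarith, by linarith⟩
  intro hk0
  rw [hk0] at e0' e1' e2'
  exact h0 ⟨by linarith, by linarith, by linarith⟩

/-- A nonzero isotropic vector on the line `a z₀ + b z₁ + c z₂ = 0`. -/
structure OnLine (a b c : ℝ) (z : C3) : Prop where
  nontrivial : ¬(a = 0 ∧ b = 0 ∧ c = 0)
  ne_zero : z ≠ 0
  isotropic : z ⬝ᵥ z = 0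
  mem : (a : ℂ) * z 0 + b * z 1 + c * z 2 = 0

/-! ### The discs of z and z̄ as the components of the line minus its real points -/

section Line
variable {a b c : ℝ} {z : C3}

lemma OnLine.star (h : OnLine a b c z) : OnLine a b c (star z) where
  nontrivial := h.nontrivial
  ne_zero := star_ne_zero.mpr h.ne_zero
  isotropic := star_isotropic h.isotropic
  mem := by
    have := congrArg Star.star h.mem
    simpa using this

lemma OnLine.combination_mem (h : OnLine a b c z) (α β : ℂ) {p : CP2}
    (hp : Represents (α • z + β • Star.star z) p) : p ∈ realLine a b c := by
  rw [hp.mem_realLine]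
  have h1 := h.mem
  have h2 := h.star.mem
  simp only [Pi.add_apply, Pi.smul_apply, smul_eq_mul]
  linear_combination α * h1 + β * h2

lemma OnLine.exists_combination (h : OnLine a b c z) {w : C3} {p : CP2} (hw : Represents w p)
    (hp : p ∈ realLine a b c) : ∃ α β : ℂ, w = α • z + β • Star.star z := by
  obtain ⟨k, hk, ha, hb, hc⟩ :=
    planeNormal_real_proportional h.ne_zero h.isotropic h.nontrivial h.mem
  apply BiranQuadric.exists_combination h.ne_zero h.isotropic
  rw [hw.mem_realLine] at hp
  have hk' : (k : ℂ) ≠ 0 := by exact_mod_cast hk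
  apply mul_left_cancel₀ hk'
  have ha' : (a : ℂ) = k * planeNormal z 0 := by exact_mod_cast ha
  have hb' : (b : ℂ) = k * planeNormal z 1 := by exact_mod_cast hb
  have hc' : (c : ℂ) = k * planeNormal z 2 := by exact_mod_cast hc
  rw [ha', hb', hc'] at hp
  linear_combination hp

lemma OnLine.disc_subset (h : OnLine a b c z) : disc z ⊆ realLine a b c \ RP2 := by
  intro p hp
  obtain ⟨ζ, hζ, hr⟩ := id hp
  refine ⟨h.combination_mem 1 ζ (by simpa using hr), ?_⟩
  obtain ⟨k, hk, hn⟩ := (hr.mem_disc h.ne_zero h.isotropic).mp hp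
  rw [hr.mem_RP2, hn, smul_eq_zero]
  exact not_or.mpr ⟨hk.ne', planeNormal_ne_zero h.ne_zero h.isotropic⟩

lemma OnLine.subset_union (h : OnLine a b c z) :
    realLine a b c \ RP2 ⊆ disc z ∪ disc (Star.star z) := by
  rintro p ⟨hp, hpr⟩
  obtain ⟨w, hw⟩ := exists_represents p
  obtain ⟨α, β, rfl⟩ := h.exists_combination hw hp
  have hn := planeNormal_combination z α β
  rw [hw.mem_RP2, hn, smul_eq_zero, not_or] at hpr
  rcases lt_or_gt_of_ne hpr.1 with hk | hk
  · right
    rw [hw.mem_disc h.star.ne_zero h.star.isotropic]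
    exact ⟨-(‖α‖ ^ 2 - ‖β‖ ^ 2), by linarith, by rw [hn, planeNormal_star, neg_smul_neg]⟩
  · left
    rw [hw.mem_disc h.ne_zero h.isotropic]
    exact ⟨_, hk, hn⟩

lemma OnLine.diff_eq (h : OnLine a b c z) :
    realLine a b c \ RP2 = disc z ∪ disc (Star.star z) :=
  h.subset_union.antisymm (Set.union_subset h.disc_subset h.star.disc_subset)

lemma OnLine.disc_ne (h : OnLine a b c z) : Disjoint (disc z) (disc (Star.star z)) := by
  rw [Set.disjoint_left]
  intro p hp hp'
  obtain ⟨w, hw⟩ := exists_represents p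
  obtain ⟨k, hk, e⟩ := (hw.mem_disc h.ne_zero h.isotropic).mp hp
  obtain ⟨k', hk', e'⟩ := (hw.mem_disc h.star.ne_zero h.star.isotropic).mp hp'
  rw [e, planeNormal_star, smul_neg, ← neg_smul] at e'
  have := smul_left_injective ℝ (planeNormal_ne_zero h.ne_zero h.isotropic) e'
  linarith

lemma conj_image_disc_subset (z : C3) : conj '' disc z ⊆ disc (star z) := by
  rintro _ ⟨p, ⟨ζ, hζ, hp⟩, rfl⟩
  refine ⟨star ζ, by simpa using hζ, ?_⟩
  simpa using hp.conj

lemma conj_conj (p : CP2) : conj (conj p) = p := by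
  obtain ⟨w, hw⟩ := exists_represents p
  have := hw.conj.conj
  rw [star_star] at this
  exact this.unique hw

lemma conj_image_disc (z : C3) : conj '' disc z = disc (star z) := by
  refine (conj_image_disc_subset z).antisymm fun p hp => ?_
  refine ⟨conj p, ?_, conj_conj p⟩
  have := conj_image_disc_subset (star z) ⟨p, hp, rfl⟩
  rwa [star_star] at this

/-- The inclusion of the line through `[z]` and `[z̄]`, in an affine coordinate. -/
def OnLine.param (h : OnLine a b c z) (ζ : ℂ) : CP2 :=
  Projectivization.mk ℂ (z + ζ • Star.star z) (add_smul_star_ne_zero h.ne_zero h.isotropic ζ)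

lemma OnLine.represents_param (h : OnLine a b c z) (ζ : ℂ) :
    Represents (z + ζ • Star.star z) (h.param ζ) := represents_mk _

lemma OnLine.continuous_param (h : OnLine a b c z) : Continuous h.param := by
  have h1 : Continuous (Projectivization.mk' ℂ : {v : C3 // v ≠ 0} → CP2) :=
    continuous_coinduced_rng
  have h2 : Continuous fun ζ : ℂ => (⟨z + ζ • Star.star z,
      add_smul_star_ne_zero h.ne_zero h.isotropic ζ⟩ : {v : C3 // v ≠ 0}) := by
    apply Continuous.subtype_mk
    fun_prop
  exact h1.comp h2

lemma OnLine.param_image_ball (h : OnLine a b c z) :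
    h.param '' Metric.ball 0 1 = disc z := by
  ext p
  constructor
  · rintro ⟨ζ, hζ, rfl⟩
    exact ⟨ζ, by simpa using hζ, h.represents_param ζ⟩
  · rintro ⟨ζ, hζ, hp⟩
    exact ⟨ζ, by simpa using hζ, (h.represents_param ζ).unique hp⟩

lemma OnLine.param_image_sphere (h : OnLine a b c z) :
    h.param '' Metric.sphere 0 1 = realLine a b c ∩ RP2 := by
  -- The normal of a combination vanishes exactly when its two coefficients have the same modulus.
  have key : ∀ α β : ℂ, ∀ p, Represents (α • z + β • Star.star z) p →
      (p ∈ RP2 ↔ ‖α‖ = ‖β‖) := by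
    intro α β p hp
    rw [hp.mem_RP2, planeNormal_combination, smul_eq_zero,
      or_iff_left (planeNormal_ne_zero h.ne_zero h.isotropic), sub_eq_zero,
      sq_eq_sq₀ (norm_nonneg _) (norm_nonneg _)]
  ext p
  constructor
  · rintro ⟨ζ, hζ, rfl⟩
    have hr : Represents ((1 : ℂ) • z + ζ • Star.star z) (h.param ζ) := by
      simpa using h.represents_param ζ
    refine ⟨h.combination_mem _ _ hr, (key _ _ _ hr).mpr ?_⟩
    simpa using hζ.symm
  · rintro ⟨hl, hr⟩
    obtain ⟨w, hw⟩ := exists_represents p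
    obtain ⟨α, β, rfl⟩ := h.exists_combination hw hl
    have e := (key _ _ _ hw).mp hr
    have hα : α ≠ 0 := by
      rintro rfl
      have : β = 0 := by simpa using e.symm
      apply hw.1
      simp [this]
    refine ⟨β / α, ?_, ?_⟩
    · simp [← e, hα]
    · refine (h.represents_param _).unique ?_
      have := hw.smul (inv_ne_zero hα)
      rwa [smul_add, smul_smul, smul_smul, inv_mul_cancel₀ hα, one_smul, ← div_eq_inv_mul] at this

/-- The points of the projective plane whose oriented real plane is on the same side as that of
`z`. -/
def halfSpace (z : C3) : Set CP2 :=
  {p | ∀ w, Represents w p → 0 < planeNormal w ⬝ᵥ planeNormal z}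

/-- In the quotient topology, openness is tested on ℂ³ \ {0}. There the condition is a strict
inequality between continuous functions, unaffected by the factor |l|² of a rescaling. -/
lemma isOpen_halfSpace (z : C3) : IsOpen (halfSpace z) := by
  rw [isOpen_coinduced]
  have : (Projectivization.mk' ℂ : {v : C3 // v ≠ 0} → CP2) ⁻¹' halfSpace z =
      {w | 0 < planeNormal w.1 ⬝ᵥ planeNormal z} := by
    ext w
    constructor
    · exact fun hw => hw w.1 (represents_mk w.2)
    · intro hw v hv
      obtain ⟨l, hl, rfl⟩ := (represents_mk w.2).exists_smul hv
      have hw' : 0 < planeNormal w.1 ⬝ᵥ planeNormal z := hw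
      rw [planeNormal_smul, smul_dotProduct, smul_eq_mul]
      have : 0 < ‖l‖ := norm_pos_iff.mpr hl
      positivity
  rw [this]
  refine isOpen_lt continuous_const ?_
  simp only [planeNormal, dotProduct, Fin.sum_univ_three, Matrix.cons_val_zero,
    Matrix.cons_val_one, Matrix.cons_val]
  have hc : ∀ i : Fin 3, Continuous fun w : {v : C3 // v ≠ 0} => w.1 i := fun i =>
    (continuous_apply i).comp continuous_subtype_val
  have hm : ∀ i j : Fin 3, Continuous fun w : {v : C3 // v ≠ 0} => (star (w.1 i) * w.1 j).im :=
    fun i j => Complex.continuous_im.comp ((hc i).star.mul (hc j))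
  exact (((hm 1 2).mul continuous_const).add ((hm 2 0).mul continuous_const)).add
    ((hm 0 1).mul continuous_const)

lemma OnLine.disc_subset_halfSpace (h : OnLine a b c z) : disc z ⊆ halfSpace z := by
  intro p hp w hw
  obtain ⟨k, hk, e⟩ := (hw.mem_disc h.ne_zero h.isotropic).mp hp
  rw [e, smul_dotProduct, smul_eq_mul]
  have : 0 < planeNormal z ⬝ᵥ planeNormal z := by
    have h1 := four_mul_planeNormal_sq z
    rw [h.isotropic, norm_zero] at h1
    have := normSq_pos h.ne_zero
    nlinarith
  positivity

/-- The disc is connected, being the image of a ball. No connected set can leave it within the line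
minus RP², because the disjoint open half spaces of z and z̄ separate the two discs. -/
lemma OnLine.side_eq (h : OnLine a b c z) {x : CP2} (hx : Represents z x) :
    side a b c x = disc z := by
  have hxm : x ∈ realLine a b c \ RP2 := h.disc_subset (self_mem_disc hx)
  refine Set.Subset.antisymm ?_ ?_
  · have hd : Disjoint (halfSpace z) (halfSpace (Star.star z)) := by
      rw [Set.disjoint_left]
      intro p hp hp'
      obtain ⟨w, hw⟩ := exists_represents p
      have h1 := hp w hw
      have h2 := hp' w hw
      rw [planeNormal_star, dotProduct_neg] at h2
      linarith
    have hsub : side a b c x ⊆ realLine a b c \ RP2 := connectedComponentIn_subset _ _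
    have h1 : side a b c x ⊆ halfSpace z := by
      refine IsPreconnected.subset_left_of_subset_union (isOpen_halfSpace z)
        (isOpen_halfSpace (Star.star z)) hd ?_ ?_ isPreconnected_connectedComponentIn
      · exact hsub.trans (h.subset_union.trans
          (Set.union_subset_union h.disc_subset_halfSpace h.star.disc_subset_halfSpace))
      · exact ⟨x, mem_connectedComponentIn hxm, h.disc_subset_halfSpace (self_mem_disc hx)⟩
    intro p hp
    rcases h.subset_union (hsub hp) with h2 | h2
    · exact h2
    · exact (Set.disjoint_left.mp hd (h1 hp) (h.star.disc_subset_halfSpace h2)).elim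
  · refine IsPreconnected.subset_connectedComponentIn ?_ (self_mem_disc hx) h.disc_subset
    rw [← h.param_image_ball]
    exact (Metric.isPreconnected_ball).image _ h.continuous_param.continuousOn

end Line

/-! ### The area and the embedding of each half -/

lemma integral_ball_fubiniStudy :
    ∫ ζ in Metric.ball (0 : ℂ) 1, 2 / Real.pi * (1 / (1 + ‖ζ‖ ^ 2) ^ 2) = 1 := by
  have h1 : ∫ ζ in Metric.ball (0 : ℂ) 1, 2 / Real.pi * (1 / (1 + ‖ζ‖ ^ 2) ^ 2) =
      ∫ ζ : ℂ, (fun r : ℝ => (Set.Iio 1).indicator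
        (fun r : ℝ => 2 / Real.pi * (1 / (1 + r ^ 2) ^ 2)) r) ‖ζ‖ := by
    rw [← MeasureTheory.integral_indicator Metric.isOpen_ball.measurableSet]
    congr 1
    ext ζ
    simp only [Set.indicator, Metric.mem_ball, dist_zero_right, Set.mem_Iio]
  have h3 : ∫ y in (0 : ℝ)..1, y / (1 + y ^ 2) ^ 2 = 1 / 4 := by
    have : ∀ y ∈ Set.uIcc (0 : ℝ) 1,
        HasDerivAt (fun y : ℝ => -(1 + y ^ 2)⁻¹ / 2) (y / (1 + y ^ 2) ^ 2) y := by
      intro y _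
      have h0 : (1 + y ^ 2) ≠ 0 := by positivity
      have hd : HasDerivAt (fun y : ℝ => 1 + y ^ 2) (2 * y) y := by
        simpa using (hasDerivAt_pow 2 y).const_add 1
      refine ((hd.inv h0).neg.div_const 2).congr_deriv ?_
      field_simp
    rw [intervalIntegral.integral_eq_sub_of_hasDerivAt this]
    · norm_num
    · apply Continuous.intervalIntegrable
      refine continuous_id.div (by fun_prop) fun y => by positivity
  rw [h1, MeasureTheory.integral_fun_norm_addHaar]
  have h2 : ∫ y in Set.Ioi (0 : ℝ), y ^ (Module.finrank ℝ ℂ - 1) • (Set.Iio 1).indicator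
        (fun r : ℝ => 2 / Real.pi * (1 / (1 + r ^ 2) ^ 2)) y = 2 / Real.pi * (1 / 4) := by
    rw [← h3, ← intervalIntegral.integral_const_mul, intervalIntegral.integral_of_le zero_le_one,
      MeasureTheory.integral_Ioc_eq_integral_Ioo]
    have : Set.Ioo (0 : ℝ) 1 = Set.Ioi 0 ∩ Set.Iio 1 := by ext; simp
    rw [this, ← MeasureTheory.setIntegral_indicator measurableSet_Iio]
    congr 1
    ext y
    simp only [Complex.finrank_real_complex, Set.indicator]
    split_ifs
    · simp; ring
    · simp
  rw [h2]
  have h4 : (MeasureTheory.volume : MeasureTheory.Measure ℂ).real (Metric.ball 0 1) = Real.pi := by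
    simp [MeasureTheory.measureReal_def, Complex.volume_ball]
  rw [h4, Complex.finrank_real_complex]
  have := Real.pi_ne_zero
  simp
  field_simp
  norm_num

/-- Isotropy makes z and z̄ orthogonal vectors of equal length. So ζ ↦ z + ζz̄ is an affine
coordinate with the usual Fubini–Study density 1/(1 + |ζ|²)², and pairing with z and z̄ reads off
the coefficients, which gives injectivity and immersion. -/
lemma OnLine.isDisc {a b c : ℝ} {z : C3} (h : OnLine a b c z) :
    IsDisc (disc z) (realLine a b c ∩ RP2) 1 := by
  have hd : ∀ ζ : ℂ, HasDerivAt (fun ζ : ℂ => z + ζ • Star.star z) (Star.star z) ζ := by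
    intro ζ
    simpa using ((hasDerivAt_id ζ).smul_const (Star.star z)).const_add z
  have hN := normSq_ne_zero h.ne_zero
  refine ⟨Set.univ, h.param, fun ζ => z + ζ • Star.star z, isOpen_univ, Set.subset_univ _,
    fun ζ _ => (hd ζ).differentiableAt.differentiableWithinAt, fun ζ _ => h.represents_param ζ,
    ?_, ?_, h.param_image_ball, h.param_image_sphere, ?_⟩
  · intro ζ _ ζ' _ e
    have h1 := h.represents_param ζ
    rw [e] at h1
    obtain ⟨l, hl, e2⟩ := h1.exists_smul (h.represents_param ζ')
    have e3 : (1 : ℂ) • z + ζ' • Star.star z = l • z + (l * ζ) • Star.star z := by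
      rw [one_smul, e2, smul_add, smul_smul]
    have f1 := congrArg (herm z) e3
    have f2 := congrArg (herm (Star.star z)) e3
    rw [herm_isotropic_combination h.isotropic, herm_isotropic_combination h.isotropic] at f1
    rw [herm_star_isotropic_combination h.isotropic,
      herm_star_isotropic_combination h.isotropic] at f2
    have g1 := mul_right_cancel₀ hN f1
    have g2 := mul_right_cancel₀ hN f2
    rw [g2, ← g1, one_mul]
  · intro ζ _ hmem
    rw [(hd ζ).deriv, (h.represents_param ζ).mem_iff] at hmem
    obtain ⟨l, hl⟩ := hmem
    have e3 : l • z + (l * ζ) • Star.star z = (0 : ℂ) • z + (1 : ℂ) • Star.star z := by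
      rw [zero_smul, zero_add, one_smul, ← smul_smul, ← smul_add, hl]
    have f1 := congrArg (herm z) e3
    rw [herm_isotropic_combination h.isotropic, herm_isotropic_combination h.isotropic] at f1
    have g1 := mul_right_cancel₀ hN f1
    rw [g1, zero_smul] at hl
    exact h.star.ne_zero hl.symm
  · refine Eq.trans ?_ integral_ball_fubiniStudy
    refine MeasureTheory.setIntegral_congr_fun measurableSet_ball fun ζ _ => ?_
    change fsForm (z + ζ • Star.star z) (deriv (fun ζ : ℂ => z + ζ • Star.star z) ζ)
      (Complex.I • deriv (fun ζ : ℂ => z + ζ • Star.star z) ζ)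
      = 2 / Real.pi * (1 / (1 + ‖ζ‖ ^ 2) ^ 2)
    rw [(hd ζ).deriv, fsForm]
    congr 1
    have e1 : herm (z + ζ • Star.star z) (Star.star z) = Star.star ζ * normSq z := by
      rw [herm_add_left, herm_smul_left, herm_star_right, h.isotropic, herm_self, normSq_star]
      simp
    have e2 : (normSq (z + ζ • Star.star z) : ℂ) = normSq z * (1 + ‖ζ‖ ^ 2) := by
      have : Star.star ζ * ζ = (‖ζ‖ : ℂ) ^ 2 := Complex.conj_mul' ζ
      rw [← this, ← herm_self, herm_add_left, herm_smul_left]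
      have f1 := herm_isotropic_combination h.isotropic 1 ζ
      have f2 := herm_star_isotropic_combination h.isotropic 1 ζ
      rw [one_smul] at f1 f2
      rw [f1, f2]
      ring
    have e1' : herm (Star.star z) (z + ζ • Star.star z) = ζ * normSq z := by
      rw [← star_herm, e1]; simp
    have hne : (1 + (‖ζ‖ : ℂ) ^ 2) ≠ 0 := by
      have : (1 + ‖ζ‖ ^ 2) ≠ 0 := by positivity
      exact_mod_cast this
    have : fsHerm (z + ζ • Star.star z) (Star.star z) (Complex.I • Star.star z)
        = ((1 / (1 + ‖ζ‖ ^ 2) ^ 2 : ℝ) : ℂ) * Complex.I := by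
      unfold fsHerm
      rw [herm_smul_right, herm_smul_right, e1, e1', e2, herm_self, normSq_star]
      have : Star.star ζ * ζ = (‖ζ‖ : ℂ) ^ 2 := Complex.conj_mul' ζ
      push_cast
      field_simp
      linear_combination -this
    rw [this, Complex.im_ofReal_mul, Complex.I_im, mul_one]

/-! ### Homogeneous coordinates on the normal bundle -/

lemma Represents.mem_tangentPlane {z w : C3} {x : CP2} (hz : Represents z x) :
    w ∈ tangentPlane x ↔ z ⬝ᵥ w = 0 := by
  constructor
  · exact fun h => h z hz.2
  · intro h v hv
    obtain ⟨l, rfl⟩ := hz.mem_iff.mp hv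
    rw [smul_dotProduct, h, smul_zero]

lemma dot_star_self (z : C3) : z ⬝ᵥ star z = normSq z := by
  rw [← herm_self, herm, dotProduct_comm]

lemma HasCoords.represents {e : NormalBundle} {y : C3 × ℂ} (h : HasCoords e y) :
    Represents y.1 e.1.1 := ⟨h.1, h.2.1⟩

lemma HasCoords.isotropic {e : NormalBundle} {y : C3 × ℂ} (h : HasCoords e y) :
    y.1 ⬝ᵥ y.1 = 0 := h.represents.mem_quadric.mp e.1.2

lemma HasCoords.mem_cone {e : NormalBundle} {y : C3 × ℂ} (h : HasCoords e y) : y ∈ cone :=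
  ⟨h.1, h.isotropic⟩

/-- Since z·z̄ = |z|² ≠ 0, the class of z̄ spans the quotient by the tangent plane, and τ is a
projection coefficient. -/
lemma exists_hasCoords (e : NormalBundle) {z : C3} (hz : Represents z e.1.1) :
    ∃ τ : ℂ, HasCoords e (z, τ) := by
  obtain ⟨u, hu⟩ := Submodule.Quotient.mk_surjective _ (e.2 ⟨z, hz.2⟩)
  have hN := normSq_ne_zero hz.1
  refine ⟨z ⬝ᵥ u / normSq z, hz.1, hz.2, ?_⟩
  rw [← hu, Submodule.Quotient.eq, hz.mem_tangentPlane, dotProduct_sub, dotProduct_smul,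
    dot_star_self, smul_eq_mul, div_mul_cancel₀ _ hN, sub_self]

lemma HasCoords.snd_unique {e : NormalBundle} {z : C3} {τ τ' : ℂ} (h : HasCoords e (z, τ))
    (h' : HasCoords e (z, τ')) : τ = τ' := by
  obtain ⟨hm, h1⟩ := h.2
  obtain ⟨_, h2⟩ := h'.2
  have h3 := h1.symm.trans h2
  rw [Submodule.Quotient.eq, h.represents.mem_tangentPlane] at h3
  simp only [dotProduct_sub, dotProduct_smul, dot_star_self, smul_eq_mul, ← sub_mul] at h3
  exact sub_eq_zero.mp ((mul_eq_zero.mp h3).resolve_right (normSq_ne_zero h.1))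

lemma HasCoords.rescale {e : NormalBundle} {y : C3 × ℂ} (h : HasCoords e y) {l : ℂ}
    (hl : l ≠ 0) : HasCoords e (rescale l y) := by
  obtain ⟨hm, h1⟩ := h.2
  refine ⟨smul_ne_zero hl h.1, e.1.1.submodule.smul_mem l hm, ?_⟩
  have h2 : (⟨l • y.1, e.1.1.submodule.smul_mem l hm⟩ : e.1.1.submodule) = l • ⟨y.1, hm⟩ := rfl
  have hl' : star l ≠ 0 := star_ne_zero.mpr hl
  simp only [BiranQuadric.rescale]
  rw [h2, map_smul, h1, ← Submodule.Quotient.mk_smul, smul_smul, star_smul, smul_smul]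
  congr 2
  field_simp

lemma HasCoords.exists_rescale {e : NormalBundle} {y y' : C3 × ℂ} (h : HasCoords e y)
    (h' : HasCoords e y') : ∃ l : ℂ, l ≠ 0 ∧ y' = BiranQuadric.rescale l y := by
  obtain ⟨l, hl, e1⟩ := h.represents.exists_smul h'.represents
  refine ⟨l, hl, Prod.ext e1 ?_⟩
  have h2 := h.rescale hl
  have h3 : HasCoords e ((BiranQuadric.rescale l y).1, y'.2) := by
    have : (BiranQuadric.rescale l y).1 = y'.1 := e1.symm
    rw [this]; exact h'
  exact h3.snd_unique h2

lemma HasCoords.smul {x : quadric} {ν : NormalSpace x.1} {z : C3} {τ : ℂ}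
    (h : HasCoords ⟨x, ν⟩ (z, τ)) (c : ℂ) : HasCoords ⟨x, c • ν⟩ (z, c * τ) := by
  obtain ⟨hm, h1⟩ := h.2
  refine ⟨h.1, hm, ?_⟩
  simp only at h1 ⊢
  rw [LinearMap.smul_apply, h1, ← Submodule.Quotient.mk_smul, smul_smul]

lemma HasCoords.ext {e e' : NormalBundle} {y : C3 × ℂ} (h : HasCoords e y)
    (h' : HasCoords e' y) : e = e' := by
  obtain ⟨x, ν⟩ := e
  obtain ⟨x', ν'⟩ := e'
  have hx : x = x' := Subtype.ext (h.represents.unique h'.represents)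
  subst hx
  congr 1
  ext ⟨v, hv⟩
  obtain ⟨l, rfl⟩ := h.represents.mem_iff.mp hv
  obtain ⟨hm, h1⟩ := h.2
  obtain ⟨_, h2⟩ := h'.2
  have e2 : (⟨l • y.1, hv⟩ : x.1.submodule) = l • ⟨y.1, hm⟩ := rfl
  rw [e2, map_smul, map_smul]
  exact congrArg (l • ·) (h1.trans h2.symm)

lemma hasCoords_zero {x : quadric} {z : C3} (hz : Represents z x.1) :
    HasCoords ⟨x, 0⟩ (z, 0) :=
  ⟨hz.1, hz.2, by simp⟩

/-! ### Gradient lines of the potential -/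

/-- The vector `planeNormal w`, normalized to length one. -/
def unitNormal (w : C3) (i : Fin 3) : ℝ :=
  planeNormal w i / √(planeNormal w ⬝ᵥ planeNormal w)

lemma unitNormal_smul {l : ℂ} (hl : l ≠ 0) (w : C3) : unitNormal (l • w) = unitNormal w := by
  ext i
  have h : 0 < ‖l‖ ^ 2 := by have := norm_pos_iff.mpr hl; positivity
  simp only [unitNormal, planeNormal_smul, smul_dotProduct, dotProduct_smul, Pi.smul_apply,
    smul_eq_mul, ← mul_assoc]
  rw [Real.sqrt_mul (by positivity), Real.sqrt_mul_self h.le, mul_div_mul_left _ _ h.ne']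

/-- The function `unitNormal` on the projective plane. -/
def unitNormalAt (p : CP2) : Fin 3 → ℝ := unitNormal p.rep

lemma Represents.unitNormalAt {w : C3} {p : CP2} (h : Represents w p) :
    unitNormalAt p = unitNormal w := by
  have h0 : Represents p.rep p := represents_iff.mpr ⟨p.rep_nonzero, p.mk_rep⟩
  obtain ⟨l, hl, e⟩ := h0.exists_smul h
  rw [e, unitNormal_smul hl, BiranQuadric.unitNormalAt]

lemma planeNormal_dot_pos {w : C3} (hn : planeNormal w ≠ 0) :
    0 < planeNormal w ⬝ᵥ planeNormal w := by
  refine lt_of_le_of_ne (Finset.sum_nonneg fun i _ => mul_self_nonneg _) (Ne.symm ?_)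
  rwa [Ne, dotProduct_self_eq_zero]

/-- If the velocity of a curve in `ℂ³` is orthogonal to `planeNormal`, then `unitNormal` is
stationary along the curve. -/
lemma hasDerivAt_unitNormal {w : ℝ → C3} {δ : C3} {t : ℝ} (hw : HasDerivAt w δ t)
    (hn : planeNormal (w t) ≠ 0) (i : Fin 3) :
    ∃ d, HasDerivAt (fun s => unitNormal (w s) i) d t ∧
      (herm δ (fun j => (planeNormal (w t) j : ℂ)) = 0 → d = 0) := by
  have hc : ∀ j, HasDerivAt (fun s => w s j) (δ j) t := hasDerivAt_pi.mp hw
  have him : ∀ j k : Fin 3, HasDerivAt (fun s => (star (w s j) * w s k).im)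
      (star (δ j) * w t k + star (w t j) * δ k).im t := fun j k =>
    Complex.imCLM.hasFDerivAt.comp_hasDerivAt t ((hc j).star.mul (hc k))
  set m : Fin 3 → ℝ := ![(star (δ 1) * w t 2 + star (w t 1) * δ 2).im,
    (star (δ 2) * w t 0 + star (w t 2) * δ 0).im,
    (star (δ 0) * w t 1 + star (w t 0) * δ 1).im] with hm
  have hpn : ∀ j, HasDerivAt (fun s => planeNormal (w s) j) (m j) t := by
    intro j
    fin_cases j
    · exact him 1 2
    · exact him 2 0
    · exact him 0 1
  have hD : HasDerivAt (fun s => planeNormal (w s) ⬝ᵥ planeNormal (w s))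
      (2 * (planeNormal (w t) ⬝ᵥ m)) t := by
    simp only [dotProduct, Fin.sum_univ_three]
    refine ((((hpn 0).mul (hpn 0)).add ((hpn 1).mul (hpn 1))).add
      ((hpn 2).mul (hpn 2))).congr_deriv ?_
    ring
  have hpos := planeNormal_dot_pos hn
  have hs : √(planeNormal (w t) ⬝ᵥ planeNormal (w t)) ≠ 0 := (Real.sqrt_pos.mpr hpos).ne'
  refine ⟨_, (hpn i).div (hD.sqrt hpos.ne') hs, fun h => ?_⟩
  have hsq := Real.sq_sqrt hpos.le
  set S := √(planeNormal (w t) ⬝ᵥ planeNormal (w t))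
  -- The derivative m of the normal n is parallel to n: by hypothesis the real and imaginary parts
  -- of the velocity lie in the real plane orthogonal to n, as do those of `w t`. Normalizing n
  -- removes such a change.
  have key : m i * (planeNormal (w t) ⬝ᵥ planeNormal (w t))
      = planeNormal (w t) i * (planeNormal (w t) ⬝ᵥ m) := by
    have h1 := congrArg Complex.re h
    have h2 := congrArg Complex.im h
    rw [herm_apply] at h1 h2
    simp only [Complex.add_re, Complex.add_im, Complex.mul_re, Complex.mul_im,
      Complex.ofReal_re, Complex.ofReal_im, Complex.star_def, Complex.conj_re, Complex.conj_im,
      mul_zero, sub_zero, zero_add, Complex.zero_re, Complex.zero_im] at h1 h2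
    have p0 : planeNormal (w t) 0 = (star (w t 1) * w t 2).im := rfl
    have p1 : planeNormal (w t) 1 = (star (w t 2) * w t 0).im := rfl
    have p2 : planeNormal (w t) 2 = (star (w t 0) * w t 1).im := rfl
    simp only [dotProduct, Fin.sum_univ_three]
    rw [p0, p1, p2] at h1 h2 ⊢
    fin_cases i <;>
    simp [hm, p0, p1, p2] at h1 h2 ⊢
    · linear_combination
        ((w t 2).im * ((w t 2).re * (w t 0).im - (w t 2).im * (w t 0).re)
          - (w t 1).im * ((w t 0).re * (w t 1).im - (w t 0).im * (w t 1).re)) * h1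
        + ((w t 2).re * ((w t 2).re * (w t 0).im - (w t 2).im * (w t 0).re)
          - (w t 1).re * ((w t 0).re * (w t 1).im - (w t 0).im * (w t 1).re)) * h2
    · linear_combination
        ((w t 0).im * ((w t 0).re * (w t 1).im - (w t 0).im * (w t 1).re)
          - (w t 2).im * ((w t 1).re * (w t 2).im - (w t 1).im * (w t 2).re)) * h1
        + ((w t 0).re * ((w t 0).re * (w t 1).im - (w t 0).im * (w t 1).re)
          - (w t 2).re * ((w t 1).re * (w t 2).im - (w t 1).im * (w t 2).re)) * h2
    · linear_combination
        ((w t 1).im * ((w t 1).re * (w t 2).im - (w t 1).im * (w t 2).re)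
          - (w t 0).im * ((w t 2).re * (w t 0).im - (w t 2).im * (w t 0).re)) * h1
        + ((w t 1).re * ((w t 1).re * (w t 2).im - (w t 1).im * (w t 2).re)
          - (w t 0).re * ((w t 2).re * (w t 0).im - (w t 2).im * (w t 0).re)) * h2
  rw [div_eq_zero_iff]
  left
  field_simp
  rw [hsq]
  linear_combination key

lemma potential_congr {u v : C3} (h : u ⬝ᵥ u = v ⬝ᵥ v) (h' : normSq u = normSq v) :
    potential u = potential v := by
  rw [potential, potential, h, h']

/-- Both w·w and |w|² take equal values at w + tu and w - tu, so the potential is even in t. -/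
lemma fderiv_potential_eq_zero {w u : C3} (h : w ⬝ᵥ u = 0) (h' : herm w u = 0) :
    fderiv ℝ potential w u = 0 := by
  by_cases hd : DifferentiableAt ℝ potential w
  · have hl : ∀ v : C3, HasDerivAt (fun t : ℝ => potential (w + t • v))
        (fderiv ℝ potential w v) 0 := by
      intro v
      have h1 : HasDerivAt (fun t : ℝ => w + t • v) v 0 := by
        simpa using ((hasDerivAt_id (0 : ℝ)).smul_const v).const_add w
      have h2 : HasFDerivAt potential (fderiv ℝ potential w) (w + (0 : ℝ) • v) := by
        simpa using hd.hasFDerivAt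
      exact h2.comp_hasDerivAt 0 h1
    have h1 := hl u
    have h2 := hl (-u)
    have he : (fun t : ℝ => potential (w + t • -u)) = fun t : ℝ => potential (w + t • u) := by
      funext t
      apply potential_congr
      · have := dotProduct_comm u w
        rw [h] at this
        simp [h, this]
      · have h3 : herm u w = 0 := by rw [← star_herm, h', star_zero]
        have h4 : ∀ v : C3, (t • v : C3) = (t : ℂ) • v := fun v => by ext; simp
        rw [normSq, normSq, h4, h4, smul_neg, ← neg_smul]
        simp only [herm_add_left, herm_add_right, herm_smul_left, herm_smul_right, h', h3]
        simp
    rw [he] at h2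
    have := h1.unique h2
    rw [map_neg] at this
    linarith
  -- Where the potential is not differentiable, `fderiv` has the default value zero.
  · rw [fderiv_zero_of_not_differentiableAt hd]; rfl

/-- Gradient vectors of the potential are orthogonal to `planeNormal`. -/
lemma herm_planeNormal_eq_zero_of_gradient {w δ : C3} (hw : w ≠ 0) {k : ℝ}
    (h : ∀ u, fsMetric w δ u = k * fderiv ℝ potential w u) :
    herm δ (fun j => (planeNormal w j : ℂ)) = 0 := by
  set n : C3 := fun j => (planeNormal w j : ℂ) with hn
  have h1 : w ⬝ᵥ n = 0 := by
    have := planeNormal_dot_self w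
    rw [dot_apply]; simp only [hn]; linear_combination this
  have h2 : herm w n = 0 := by
    have := congrArg star (planeNormal_dot_self w)
    rw [herm_apply]; simp [hn] at this ⊢; linear_combination this
  -- Testing against this multiple of n turns the metric into a positive multiple of |⟨δ, n⟩|².
  set c := star (herm δ n)
  have h3 := h (c • n)
  rw [fderiv_potential_eq_zero (by rw [dotProduct_smul, h1, smul_zero])
    (by rw [herm_smul_right, h2, mul_zero]), mul_zero, fsMetric, fsHerm, herm_smul_right,
    herm_smul_right, h2, mul_zero, mul_zero, sub_zero] at h3
  have hN := (normSq_pos hw).ne'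
  have h4 : (c * herm δ n) = ((‖herm δ n‖ ^ 2 : ℝ) : ℂ) := by
    have := Complex.conj_mul' (herm δ n)
    push_cast; exact this
  rw [h4] at h3
  have h5 : (((‖herm δ n‖ ^ 2 : ℝ) : ℂ) * normSq w / (normSq w : ℂ) ^ 2).re
      = ‖herm δ n‖ ^ 2 / normSq w := by
    rw [← Complex.ofReal_mul, ← Complex.ofReal_pow, ← Complex.ofReal_div, Complex.ofReal_re]
    field_simp
  rw [h5] at h3
  have hpi := Real.pi_ne_zero
  simpa [hpi, hN] using h3

/-! ### The fibres of Biran's disc bundle -/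

namespace BiranDiscBundle

lemma notMem_RP2 (B : BiranDiscBundle) {e : NormalBundle} (he : B.metric.norm e < 1) :
    B.toFun e ∉ RP2 := by
  have : B.toFun e ∈ RP2ᶜ := B.image_eq ▸ ⟨e, he, rfl⟩
  exact this

/-- Along the radius t ↦ tν the velocity is a gradient vector for t ≠ 0, so the unit normal is
stationary there. At t = 0 the gradient condition says nothing, but the mean value theorem needs
only continuity at the endpoints. -/
lemma unitNormalAt_toFun (B : BiranDiscBundle) (x : quadric) (ν : NormalSpace x.1)
    (he : B.metric.norm ⟨x, ν⟩ < 1) :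
    unitNormalAt (B.toFun ⟨x, ν⟩) = unitNormalAt x.1 := by
  obtain ⟨z, hz⟩ := exists_represents x.1
  obtain ⟨τ, hτ⟩ := exists_hasCoords ⟨x, ν⟩ hz
  by_cases hτ0 : τ = 0
  · subst hτ0
    rw [hτ.ext (hasCoords_zero hz), B.zero_section]
  have hcoords : ∀ t : ℝ, HasCoords ⟨x, (t : ℂ) • ν⟩ (z, (t : ℂ) * τ) := fun t => hτ.smul t
  have hnorm : ∀ t ∈ Set.Icc (0 : ℝ) 1, B.metric.norm ⟨x, (t : ℂ) • ν⟩ < 1 := by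
    intro t ht
    rw [B.metric.norm_smul, Complex.norm_real, Real.norm_of_nonneg ht.1]
    rcases le_or_gt (B.metric.norm ⟨x, ν⟩) 0 with h | h
    · exact (mul_nonpos_of_nonneg_of_nonpos ht.1 h).trans_lt one_pos
    · nlinarith [ht.2]
  have hderiv : ∀ t ∈ Set.Icc (0 : ℝ) 1, ∀ i, ∃ d,
      HasDerivAt (fun s : ℝ => unitNormalAt (B.toFun ⟨x, (s : ℂ) • ν⟩) i) d t ∧
      (t ≠ 0 → d = 0) := by
    intro t ht i
    obtain ⟨G, hG⟩ := B.smooth _ _ (hnorm t ht) (hcoords t)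
    have hc : HasDerivAt (fun s : ℝ => ((z, (s : ℂ) * τ) : C3 × ℂ)) (0, τ) t := by
      have h1 : HasDerivAt (fun s : ℝ => (s : ℂ) * τ) τ t := by
        simpa using (Complex.ofRealCLM.hasDerivAt (x := t)).mul_const τ
      exact (hasDerivAt_const t z).prodMk h1
    have hw : HasDerivAt (fun s : ℝ => G (z, (s : ℂ) * τ))
        (fderiv ℝ G (z, (t : ℂ) * τ) (0, τ)) t :=
      ((hG.1.differentiableAt (by simp)).hasFDerivAt).comp_hasDerivAt t hc
    have hrep := hc.continuousAt.eventually hG.2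
    have hrt := hrep.self_of_nhds _ (hcoords t)
    have hn : planeNormal (G (z, (t : ℂ) * τ)) ≠ 0 := fun h0 =>
      B.notMem_RP2 (hnorm t ht) (hrt.mem_RP2.mpr h0)
    obtain ⟨d, hd, hd0⟩ := hasDerivAt_unitNormal hw hn i
    refine ⟨d, hd.congr_of_eventuallyEq ?_, fun ht0 => hd0 ?_⟩
    · filter_upwards [hrep] with s hs
      rw [(hs _ (hcoords s)).unitNormalAt]
    · have htc : (t : ℂ) ≠ 0 := by exact_mod_cast ht0
      obtain ⟨k, hk⟩ := B.gradient _ _ G (hnorm t ht) (hcoords t) (mul_ne_zero htc hτ0) hG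
      have h1 := herm_planeNormal_eq_zero_of_gradient hrt.1 hk
      -- The gradient condition concerns the radial vector (0, tτ), the curve has velocity (0, τ);
      -- they differ by the factor t ≠ 0.
      have h2 : ((0, (t : ℂ) * τ) : C3 × ℂ) = t • (0, τ) := by
        ext <;> simp
      have h3 : fderiv ℝ G (z, (t : ℂ) * τ) (0, (t : ℂ) * τ) =
          (t : ℂ) • fderiv ℝ G (z, (t : ℂ) * τ) (0, τ) := by
        rw [h2, map_smul]; ext; simp
      simp only at h1
      rw [h3, herm_smul_left] at h1
      exact (mul_eq_zero.mp h1).resolve_left (star_ne_zero.mpr htc)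
  ext i
  have h01 := exists_hasDerivAt_eq_slope
    (fun s : ℝ => unitNormalAt (B.toFun ⟨x, (s : ℂ) • ν⟩) i) (fun _ => 0) one_pos
    (fun t ht => by
      obtain ⟨d, hd, _⟩ := hderiv t ht i
      exact hd.continuousAt.continuousWithinAt)
    (fun t ht => by
      obtain ⟨d, hd, hd0⟩ := hderiv t ⟨ht.1.le, ht.2.le⟩ i
      rwa [hd0 ht.1.ne'] at hd)
  obtain ⟨_, _, h⟩ := h01
  simp only [Complex.ofReal_one, one_smul, Complex.ofReal_zero, zero_smul, sub_zero, div_one] at h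
  rw [B.zero_section] at h
  linarith

lemma fibre_subset_disc (B : BiranDiscBundle) {x : CP2} {z : C3} (hz : Represents z x)
    (hzz : z ⬝ᵥ z = 0) : B.fibre x ⊆ disc z := by
  rintro _ ⟨⟨x', ν⟩, ⟨rfl, he⟩, rfl⟩
  obtain ⟨w, hw⟩ := exists_represents (B.toFun ⟨x', ν⟩)
  have h1 := B.unitNormalAt_toFun x' ν he
  rw [hw.unitNormalAt, hz.unitNormalAt] at h1
  have hnw : planeNormal w ≠ 0 := fun h => B.notMem_RP2 he (hw.mem_RP2.mpr h)
  have p1 := Real.sqrt_pos.mpr (planeNormal_dot_pos hnw)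
  have p2 := Real.sqrt_pos.mpr (planeNormal_dot_pos (planeNormal_ne_zero hz.1 hzz))
  rw [hw.mem_disc hz.1 hzz]
  refine ⟨_, div_pos p1 p2, ?_⟩
  ext i
  have := congrFun h1 i
  simp only [unitNormal] at this
  rw [Pi.smul_apply, smul_eq_mul]
  field_simp at this ⊢
  linarith

end BiranDiscBundle

/-- Discs that meet have positively proportional normals, so [z'] lies in the disc of z. The square
of z + ζz̄ is 2ζ|z|², so its centre is the only point of a disc on the quadric. -/
lemma eq_of_disc_inter {x x' p : CP2} {z z' : C3} (hz : Represents z x) (hzz : z ⬝ᵥ z = 0)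
    (hz' : Represents z' x') (hzz' : z' ⬝ᵥ z' = 0) (hp : p ∈ disc z) (hp' : p ∈ disc z') :
    x' = x := by
  obtain ⟨w, hw⟩ := exists_represents p
  obtain ⟨k, hk, e⟩ := (hw.mem_disc hz.1 hzz).mp hp
  obtain ⟨k', hk', e'⟩ := (hw.mem_disc hz'.1 hzz').mp hp'
  have h1 : x' ∈ disc z := by
    rw [hz'.mem_disc hz.1 hzz]
    refine ⟨k'⁻¹ * k, by positivity, ?_⟩
    rw [mul_smul, ← e, e', smul_smul, inv_mul_cancel₀ hk'.ne', one_smul]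
  obtain ⟨ζ, _, hr⟩ := h1
  have h2 : x' ∈ quadric := hz'.mem_quadric.mpr hzz'
  rw [hr.mem_quadric] at h2
  have h3 : ζ = 0 := by
    simp only [add_dotProduct, dotProduct_add, smul_dotProduct, dotProduct_smul, hzz,
      dot_star_self, star_isotropic hzz, smul_eq_mul] at h2
    rw [dotProduct_comm, dot_star_self] at h2
    have h4 : (2 * normSq z : ℂ) * ζ = 0 := by linear_combination h2
    exact (mul_eq_zero.mp h4).resolve_left (mul_ne_zero two_ne_zero (normSq_ne_zero hz.1))
  rw [h3, zero_smul, add_zero] at hr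
  exact hr.unique hz

/-- A point of the disc is non-real, hence lies in some fibre, and that fibre sits in its own disc;
disjointness of the discs identifies the base point. -/
lemma BiranDiscBundle.fibre_eq (B : BiranDiscBundle) {x : CP2} {z : C3} (hz : Represents z x)
    (hzz : z ⬝ᵥ z = 0) : B.fibre x = disc z := by
  refine (B.fibre_subset_disc hz hzz).antisymm fun p hp => ?_
  have hpr : p ∈ RP2ᶜ := by
    obtain ⟨w, hw⟩ := exists_represents p
    obtain ⟨k, hk, e⟩ := (hw.mem_disc hz.1 hzz).mp hp
    intro h
    rw [hw.mem_RP2, e, smul_eq_zero] at h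
    exact h.elim hk.ne' (planeNormal_ne_zero hz.1 hzz)
  rw [← B.image_eq] at hpr
  obtain ⟨e, he, rfl⟩ := hpr
  obtain ⟨z', hz'⟩ := exists_represents e.1.1
  have hzz' := hz'.mem_quadric.mp e.1.2
  have h1 := B.fibre_subset_disc hz' hzz' ⟨e, ⟨rfl, he⟩, rfl⟩
  exact ⟨e, ⟨eq_of_disc_inter hz hzz hz' hzz' hp h1, he⟩, rfl⟩

/-- With n = (a, b, c) and a nonzero real q orthogonal to n, the vector z = q × n + i|n|q works: its
real and imaginary parts are orthogonal to n and to each other, and have equal length. -/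
lemma exists_onLine (a b c : ℝ) (h0 : ¬(a = 0 ∧ b = 0 ∧ c = 0)) : ∃ z, OnLine a b c z := by
  obtain ⟨q0, q1, q2, hq, hq0⟩ : ∃ q0 q1 q2 : ℝ, a * q0 + b * q1 + c * q2 = 0 ∧
      0 < q0 ^ 2 + q1 ^ 2 + q2 ^ 2 := by
    by_cases hab : a = 0 ∧ b = 0
    · exact ⟨1, 0, 0, by rw [hab.1]; ring, by norm_num⟩
    · refine ⟨-b, a, 0, by ring, ?_⟩
      rcases not_and_or.mp hab with h | h
      · have := sq_pos_of_ne_zero h; nlinarith [sq_nonneg b]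
      · have := sq_pos_of_ne_zero h; nlinarith [sq_nonneg a]
  have hN : 0 < a ^ 2 + b ^ 2 + c ^ 2 := by
    by_contra! h
    exact h0 ⟨by nlinarith [sq_nonneg a, sq_nonneg b, sq_nonneg c],
      by nlinarith [sq_nonneg a, sq_nonneg b, sq_nonneg c],
      by nlinarith [sq_nonneg a, sq_nonneg b, sq_nonneg c]⟩
  set N := √(a ^ 2 + b ^ 2 + c ^ 2) with hNd
  have hN2 : N ^ 2 = a ^ 2 + b ^ 2 + c ^ 2 := Real.sq_sqrt hN.le
  have hNpos : 0 < N := Real.sqrt_pos.mpr hN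
  have hqC : (a : ℂ) * q0 + b * q1 + c * q2 = 0 := by exact_mod_cast hq
  have hNC : (N : ℂ) ^ 2 = a ^ 2 + b ^ 2 + c ^ 2 := by exact_mod_cast hN2
  refine ⟨![((q1 * c - q2 * b : ℝ) : ℂ) + (N * q0 : ℝ) * Complex.I,
    ((q2 * a - q0 * c : ℝ) : ℂ) + (N * q1 : ℝ) * Complex.I,
    ((q0 * b - q1 * a : ℝ) : ℂ) + (N * q2 : ℝ) * Complex.I], h0, ?_, ?_, ?_⟩
  · intro h
    have e0 := congrArg Complex.im (congrFun h 0)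
    have e1 := congrArg Complex.im (congrFun h 1)
    have e2 := congrArg Complex.im (congrFun h 2)
    simp [hNpos.ne'] at e0 e1 e2
    rw [e0, e1, e2] at hq0
    norm_num at hq0
  · rw [dot_apply]
    simp
    linear_combination (-(q0 : ℂ) ^ 2 - q1 ^ 2 - q2 ^ 2) * hNC
      - ((a : ℂ) * q0 + b * q1 + c * q2) * hqC
      + (N : ℂ) ^ 2 * ((q0 : ℂ) ^ 2 + q1 ^ 2 + q2 ^ 2) * Complex.I_sq
  · simp
    linear_combination (N : ℂ) * Complex.I * hqC

lemma OnLine.inter_quadric {a b c : ℝ} {z : C3} (h : OnLine a b c z) {x : CP2}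
    (hx : Represents z x) : realLine a b c ∩ quadric = {x, conj x} := by
  ext p
  simp only [Set.mem_inter_iff, Set.mem_insert_iff, Set.mem_singleton_iff]
  constructor
  · rintro ⟨hl, hq⟩
    obtain ⟨w, hw⟩ := exists_represents p
    have hww := hw.mem_quadric.mp hq
    have hpr : p ∉ RP2 := fun hr => planeNormal_ne_zero hw.1 hww (hw.mem_RP2.mp hr)
    rcases h.subset_union ⟨hl, hpr⟩ with hd | hd
    · left; exact eq_of_disc_inter hx h.isotropic hw hww hd (self_mem_disc hw)
    · right; exact eq_of_disc_inter hx.conj h.star.isotropic hw hww hd (self_mem_disc hw)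
  · rintro (rfl | rfl)
    · exact ⟨(h.disc_subset (self_mem_disc hx)).1, hx.mem_quadric.mpr h.isotropic⟩
    · exact ⟨(h.star.disc_subset (self_mem_disc hx.conj)).1,
        hx.conj.mem_quadric.mpr h.star.isotropic⟩

lemma OnLine.conj_ne {a b c : ℝ} {z : C3} (h : OnLine a b c z) {x : CP2}
    (hx : Represents z x) : conj x ≠ x := fun e =>
  Set.disjoint_left.mp h.disc_ne (self_mem_disc hx) (e ▸ self_mem_disc hx.conj)

/-! ### The standard metric and the standard connection form -/

lemma exists_hasCoords_of_mem_cone {y : C3 × ℂ} (hy : y ∈ cone) : ∃ e, HasCoords e y := by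
  have hr := represents_mk hy.1
  have hN := normSq_ne_zero hy.1
  let x : quadric := ⟨Projectivization.mk ℂ y.1 hy.1, hr.mem_quadric.mpr hy.2⟩
  let ν : NormalSpace x.1 :=
    { toFun := fun v => Submodule.Quotient.mk ((herm y.1 v.1 / normSq y.1) • (y.2 • star y.1))
      map_add' := fun u v => by
        rw [← Submodule.Quotient.mk_add, ← add_smul, ← add_div, ← herm_add_right]; rfl
      map_smul' := fun c v => by
        have h : herm y.1 (c • v).1 = c * herm y.1 v.1 := herm_smul_right c y.1 v.1
        rw [RingHom.id_apply, ← Submodule.Quotient.mk_smul, h, mul_div_assoc, mul_smul] }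
  refine ⟨⟨x, ν⟩, hy.1, hr.2, ?_⟩
  change Submodule.Quotient.mk ((herm y.1 y.1 / normSq y.1) • (y.2 • star y.1)) = _
  rw [herm_self, div_self hN, one_smul]

lemma exists_coords (e : NormalBundle) : ∃ y, HasCoords e y := by
  obtain ⟨z, hz⟩ := exists_represents e.1.1
  obtain ⟨τ, h⟩ := exists_hasCoords e hz
  exact ⟨_, h⟩

/-- A choice of homogeneous coordinates of a point of the normal bundle. -/
def coords (e : NormalBundle) : C3 × ℂ := (exists_coords e).choose

lemma hasCoords_coords (e : NormalBundle) : HasCoords e (coords e) := (exists_coords e).choose_spec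

lemma norm_div_star {l : ℂ} (hl : l ≠ 0) : ‖l / star l‖ = 1 := by
  rw [norm_div, norm_star, div_self (norm_ne_zero_iff.mpr hl)]

lemma HasCoords.norm_coords {e : NormalBundle} {y : C3 × ℂ} (h : HasCoords e y) :
    ‖(coords e).2‖ = ‖y.2‖ := by
  obtain ⟨l, hl, e1⟩ := h.exists_rescale (hasCoords_coords e)
  rw [e1, BiranQuadric.rescale, norm_mul, norm_div_star hl, one_mul]

/-- The metric in which the point with the homogeneous coordinates `(z, τ)` has norm `|τ|`. -/
def stdMetric : HermitianMetric where
  norm e := ‖(coords e).2‖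
  weight _ := 1
  norm_eq e y h := by rw [h.norm_coords, one_mul]
  norm_smul x ν c := by
    obtain ⟨z, hz⟩ := exists_represents x.1
    obtain ⟨τ, h⟩ := exists_hasCoords ⟨x, ν⟩ hz
    rw [h.norm_coords, (h.smul c).norm_coords, norm_mul]
  norm_pos x ν hν := by
    obtain ⟨z, hz⟩ := exists_represents x.1
    obtain ⟨τ, h⟩ := exists_hasCoords ⟨x, ν⟩ hz
    rw [h.norm_coords, norm_pos_iff]
    rintro rfl
    apply hν
    have := h.ext (hasCoords_zero hz)
    simpa using this
  smooth := contDiffOn_const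

lemma HasCoords.stdMetric_norm {e : NormalBundle} {y : C3 × ℂ} (h : HasCoords e y) :
    stdMetric.norm e = ‖y.2‖ := h.norm_coords

/-! ### Real smoothness of Hermitian expressions -/

section Smooth
variable {E : Type*} [NormedAddCommGroup E] [NormedSpace ℝ E] {n : WithTop ℕ∞}

lemma contDiffAt_star {f : E → ℂ} {y : E} (hf : ContDiffAt ℝ n f y) :
    ContDiffAt ℝ n (fun x => star (f x)) y :=
  Complex.conjCLE.contDiff.contDiffAt.comp y hf

lemma contDiffAt_star_pi {f : E → C3} {y : E} (hf : ContDiffAt ℝ n f y) :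
    ContDiffAt ℝ n (fun x => star (f x)) y :=
  contDiffAt_pi.mpr fun i => contDiffAt_star (contDiffAt_pi.mp hf i)

lemma contDiffAt_herm {f g : E → C3} {y : E} (hf : ContDiffAt ℝ n f y)
    (hg : ContDiffAt ℝ n g y) : ContDiffAt ℝ n (fun x => herm (f x) (g x)) y := by
  simp only [herm_apply]
  have h : ∀ i, ContDiffAt ℝ n (fun x => star (f x i) * g x i) y := fun i =>
    (contDiffAt_star (contDiffAt_pi.mp hf i)).mul (contDiffAt_pi.mp hg i)
  exact ((h 0).add (h 1)).add (h 2)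

lemma contDiffAt_re {f : E → ℂ} {y : E} (hf : ContDiffAt ℝ n f y) :
    ContDiffAt ℝ n (fun x => (f x).re) y :=
  Complex.reCLM.contDiff.contDiffAt.comp y hf

lemma contDiffAt_im {f : E → ℂ} {y : E} (hf : ContDiffAt ℝ n f y) :
    ContDiffAt ℝ n (fun x => (f x).im) y :=
  Complex.imCLM.contDiff.contDiffAt.comp y hf

lemma contDiffAt_ofReal {f : E → ℝ} {y : E} (hf : ContDiffAt ℝ n f y) :
    ContDiffAt ℝ n (fun x => (f x : ℂ)) y :=
  Complex.ofRealCLM.contDiff.contDiffAt.comp y hf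

lemma contDiffAt_normSq {f : E → C3} {y : E} (hf : ContDiffAt ℝ n f y) :
    ContDiffAt ℝ n (fun x => normSq (f x)) y :=
  contDiffAt_re (contDiffAt_herm hf hf)

lemma contDiffAt_dot {f g : E → C3} {y : E} (hf : ContDiffAt ℝ n f y)
    (hg : ContDiffAt ℝ n g y) : ContDiffAt ℝ n (fun x => f x ⬝ᵥ g x) y := by
  simp only [← herm_star_left]
  exact contDiffAt_herm (contDiffAt_star_pi hf) hg

lemma contDiffAt_norm_sq {f : E → ℂ} {y : E} (hf : ContDiffAt ℝ n f y) :
    ContDiffAt ℝ n (fun x => ‖f x‖ ^ 2) y := by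
  simp only [Complex.sq_norm, Complex.normSq_apply]
  exact ((contDiffAt_re hf).mul (contDiffAt_re hf)).add ((contDiffAt_im hf).mul (contDiffAt_im hf))

end Smooth

lemma real_smul_eq (t : ℝ) (v : C3) : t • v = (t : ℂ) • v := by ext; simp

/-- The form `(1 / 2π) Im (dτ / τ) - (1 / π) Im ⟨z, dz⟩ / |z|²`. -/
def stdConnectionLinear (y : C3 × ℂ) : C3 × ℂ →ₗ[ℝ] ℝ where
  toFun v := (v.2 / y.2).im / (2 * Real.pi) - (herm y.1 v.1).im / (Real.pi * normSq y.1)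
  map_add' u v := by
    simp only [Prod.fst_add, Prod.snd_add, herm_add_right, add_div, Complex.add_im]
    ring
  map_smul' t v := by
    simp only [Prod.smul_fst, Prod.smul_snd, real_smul_eq, herm_smul_right, Complex.real_smul,
      mul_div_assoc, Complex.im_ofReal_mul, RingHom.id_apply, smul_eq_mul]
    ring

/-- `stdConnectionLinear` as a differential form. -/
def stdConnectionForm (y : C3 × ℂ) : (C3 × ℂ) [⋀^Fin 1]→L[ℝ] ℝ :=
  ContinuousAlternatingMap.ofSubsingletonLIE (0 : Fin 1)
    (LinearMap.toContinuousLinearMap (stdConnectionLinear y))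

lemma stdConnectionForm_apply (y v : C3 × ℂ) : stdConnectionForm y ![v] =
    (v.2 / y.2).im / (2 * Real.pi) - (herm y.1 v.1).im / (Real.pi * normSq y.1) := rfl

lemma contDiffOn_stdConnectionForm :
    ContDiffOn ℝ ∞ stdConnectionForm {y | y.1 ≠ 0 ∧ y.2 ≠ 0} := by
  refine (ContinuousAlternatingMap.ofSubsingletonLIE (𝕜 := ℝ) (E := C3 × ℂ) (F := ℝ)
    (0 : Fin 1)).toContinuousLinearEquiv.contDiff.comp_contDiffOn ?_
  rw [contDiffOn_clm_apply]
  rintro v y ⟨h1, h2⟩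
  apply ContDiffAt.contDiffWithinAt
  change ContDiffAt ℝ ∞ (fun y : C3 × ℂ => (v.2 / y.2).im / (2 * Real.pi)
    - (herm y.1 v.1).im / (Real.pi * normSq y.1)) y
  refine ContDiffAt.sub (ContDiffAt.div_const (contDiffAt_im ?_) _) (ContDiffAt.div ?_ ?_ ?_)
  · simp only [div_eq_mul_inv]
    exact contDiffAt_const.mul (contDiffAt_snd.inv h2)
  · exact contDiffAt_im (contDiffAt_herm contDiffAt_fst contDiffAt_const)
  · exact contDiffAt_const.mul (contDiffAt_normSq contDiffAt_fst)
  · exact mul_ne_zero Real.pi_ne_zero (normSq_pos h1).ne'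

lemma contDiffAt_stdConnectionForm {y : C3 × ℂ} (h1 : y.1 ≠ 0) (h2 : y.2 ≠ 0) :
    ContDiffAt ℝ ∞ stdConnectionForm y := by
  refine contDiffOn_stdConnectionForm.contDiffAt (IsOpen.mem_nhds ?_ ⟨h1, h2⟩)
  exact (isOpen_ne_fun continuous_fst continuous_const).inter
    (isOpen_ne_fun continuous_snd continuous_const)

/-! ### Line derivatives and the curvature of the connection form -/

lemma fderiv_eq_of_hasDerivAt_line {E F : Type*} [NormedAddCommGroup E] [NormedSpace ℝ E]
    [NormedAddCommGroup F] [NormedSpace ℝ F] {f : E → F} {y v : E} {d : F}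
    (hf : DifferentiableAt ℝ f y) (h : HasDerivAt (fun t : ℝ => f (y + t • v)) d 0) :
    fderiv ℝ f y v = d := by
  have h1 : HasDerivAt (fun t : ℝ => y + t • v) v 0 := by
    simpa using ((hasDerivAt_id (0 : ℝ)).smul_const v).const_add y
  have h2 : HasFDerivAt f (fderiv ℝ f y) (y + (0 : ℝ) • v) := by
    simpa using hf.hasFDerivAt
  exact (h2.comp_hasDerivAt 0 h1).unique h

lemma extDeriv_apply_two {E : Type*} [NormedAddCommGroup E] [NormedSpace ℝ E]
    {η : E → E [⋀^Fin 1]→L[ℝ] ℝ} {y : E} (h : DifferentiableAt ℝ η y) (v w : E) :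
    extDeriv η y ![v, w] =
      fderiv ℝ (fun x => η x ![w]) y v - fderiv ℝ (fun x => η x ![v]) y w := by
  rw [extDeriv_apply h, Fin.sum_univ_two]
  have h0 : (0 : Fin 2).removeNth ![v, w] = ![w] := by
    ext i; fin_cases i; rfl
  have h1 : (1 : Fin 2).removeNth ![v, w] = ![v] := by
    ext i; fin_cases i; rfl
  rw [h0, h1]
  simp
  ring

lemma normSq_add_smul (z v : C3) (t : ℝ) :
    normSq (z + t • v) = normSq z + 2 * (herm z v).re * t + normSq v * t ^ 2 := by
  have h : (herm v z).re = (herm z v).re := by rw [← star_herm]; simp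
  rw [real_smul_eq, normSq, normSq, normSq, herm_add_left, herm_add_right, herm_add_right,
    herm_smul_left, herm_smul_right, herm_smul_left, herm_smul_right]
  simp [h]
  ring

lemma hasDerivAt_normSq_line (z v : C3) :
    HasDerivAt (fun t : ℝ => normSq (z + t • v)) (2 * (herm z v).re) 0 := by
  simp only [normSq_add_smul]
  refine ((((hasDerivAt_id (0 : ℝ)).const_mul (2 * (herm z v).re)).const_add (normSq z)).add
    ((hasDerivAt_pow 2 (0 : ℝ)).const_mul (normSq v))).congr_deriv ?_
  simp

lemma hasDerivAt_herm_line (z v w : C3) :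
    HasDerivAt (fun t : ℝ => herm (z + t • v) w) (herm v w) 0 := by
  have h : (fun t : ℝ => herm (z + t • v) w) = fun t : ℝ => herm z w + t • herm v w := by
    funext t
    rw [real_smul_eq, herm_add_left, herm_smul_left]
    simp
  rw [h]
  simpa using ((hasDerivAt_id (0 : ℝ)).smul_const (herm v w)).const_add (herm z w)

lemma hasDerivAt_im {f : ℝ → ℂ} {d : ℂ} {t : ℝ} (h : HasDerivAt f d t) :
    HasDerivAt (fun s => (f s).im) d.im t :=
  Complex.imCLM.hasFDerivAt.comp_hasDerivAt t h

lemma hasDerivAt_re {f : ℝ → ℂ} {d : ℂ} {t : ℝ} (h : HasDerivAt f d t) :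
    HasDerivAt (fun s => (f s).re) d.re t :=
  Complex.reCLM.hasFDerivAt.comp_hasDerivAt t h

lemma hasDerivAt_line {E : Type*} [NormedAddCommGroup E] [NormedSpace ℝ E] (z v : E) :
    HasDerivAt (fun t : ℝ => z + t • v) v 0 := by
  simpa using ((hasDerivAt_id (0 : ℝ)).smul_const v).const_add z

lemma differentiableAt_stdConnectionForm_apply {y : C3 × ℂ} (h1 : y.1 ≠ 0) (h2 : y.2 ≠ 0)
    (w : C3 × ℂ) : DifferentiableAt ℝ (fun x => stdConnectionForm x ![w]) y := by
  have h := (contDiffAt_stdConnectionForm h1 h2).differentiableAt (by simp)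
  exact h.continuousAlternatingMap_apply_const ![w]

lemma fderiv_stdConnectionForm {y : C3 × ℂ} (h1 : y.1 ≠ 0) (h2 : y.2 ≠ 0) (v w : C3 × ℂ) :
    fderiv ℝ (fun x => stdConnectionForm x ![w]) y v =
      (-(w.2 * v.2 / y.2 ^ 2)).im / (2 * Real.pi)
        - ((herm v.1 w.1).im * normSq y.1 - (herm y.1 w.1).im * (2 * (herm y.1 v.1).re))
          / (Real.pi * normSq y.1 ^ 2) := by
  apply fderiv_eq_of_hasDerivAt_line (differentiableAt_stdConnectionForm_apply h1 h2 w)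
  have hpi := Real.pi_ne_zero
  have hN := (normSq_pos h1).ne'
  have d1 : HasDerivAt (fun t : ℝ => w.2 / (y.2 + t • v.2)) (-(w.2 * v.2 / y.2 ^ 2)) 0 := by
    have := (hasDerivAt_const (0 : ℝ) w.2).div (hasDerivAt_line y.2 v.2) (by simpa using h2)
    refine this.congr_deriv ?_
    simp
    ring
  have d2 := hasDerivAt_im (hasDerivAt_herm_line y.1 v.1 w.1)
  have d3 := (hasDerivAt_normSq_line y.1 v.1).const_mul Real.pi
  refine (((hasDerivAt_im d1).div_const (2 * Real.pi)).sub
    (d2.div d3 (by simpa [hpi] using hN))).congr_deriv ?_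
  simp only [zero_smul, add_zero]
  field_simp

lemma fsForm_eq (w u v : C3) : fsForm w u v =
    2 / Real.pi * (((herm u v).im * normSq w
      - ((herm w u).re * (herm w v).im - (herm w u).im * (herm w v).re)) / normSq w ^ 2) := by
  rw [fsForm, fsHerm]
  congr 1
  rw [← Complex.ofReal_pow, Complex.div_ofReal_im, ← star_herm w u]
  simp
  ring

/-- The angular term Im(dτ/τ) is closed, its derivative being symmetric in v and w. The term in z is
a primitive of minus the Fubini–Study form on all of ℂ³ \ {0}, so no tangency to the cone is needed.
-/
lemma extDeriv_stdConnectionForm {y : C3 × ℂ} (h1 : y.1 ≠ 0) (h2 : y.2 ≠ 0) (v w : C3 × ℂ) :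
    extDeriv stdConnectionForm y ![v, w] = -fsForm y.1 v.1 w.1 := by
  rw [extDeriv_apply_two ((contDiffAt_stdConnectionForm h1 h2).differentiableAt (by simp)),
    fderiv_stdConnectionForm h1 h2, fderiv_stdConnectionForm h1 h2, fsForm_eq,
    ← star_herm v.1 w.1, mul_comm v.2 w.2]
  have hpi := Real.pi_ne_zero
  have hN := (normSq_pos h1).ne'
  simp
  field_simp
  ring

/-- The standard connection form on the normal bundle of the quadric. -/
def stdConnection : ConnectionForm where
  form := stdConnectionForm
  smooth := contDiffOn_stdConnectionForm
  rescale_inv y hy hτ v _ l hl := by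
    have hl' : star l ≠ 0 := star_ne_zero.mpr hl
    simp only [stdConnectionForm_apply, rescale]
    have e1 : l / star l * v.2 / (l / star l * y.2) = v.2 / y.2 := by field_simp
    have e2 : herm (l • y.1) (l • v.1) = ((‖l‖ ^ 2 : ℝ) : ℂ) * herm y.1 v.1 := by
      have : star l * l = (‖l‖ : ℂ) ^ 2 := Complex.conj_mul' l
      rw [herm_smul_left, herm_smul_right, ← mul_assoc, this]
      push_cast; rfl
    have hn : ‖l‖ ≠ 0 := norm_ne_zero_iff.mpr hl
    have hN := (normSq_pos hy.1).ne'
    rw [e1, e2, normSq_smul, Complex.im_ofReal_mul]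
    congr 1
    have hpi := Real.pi_ne_zero
    field_simp
  -- This vector turns τ at the speed 2 Im c; the coefficient 1/π of the term in z is chosen to
  -- cancel that.
  vertical y hy hτ c := by
    have hN := (normSq_pos hy.1).ne'
    have hpi := Real.pi_ne_zero
    rw [stdConnectionForm_apply]
    simp only [herm_smul_right, herm_self, mul_div_cancel_right₀ _ hτ]
    simp
    field_simp
    ring
  fibre_inv y hy hτ v _ c hc := by
    rw [stdConnectionForm_apply, stdConnectionForm_apply]
    simp only [mul_div_mul_left _ _ hc]
  radial y hy hτ := by
    rw [stdConnectionForm_apply]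
    simp [hτ, herm]
  angular y hy hτ := by
    rw [stdConnectionForm_apply]
    simp [hτ, herm]
  curvature y hy hτ v _ w _ := extDeriv_stdConnectionForm hy.1 hτ v w

/-! ### The standard disc bundle -/

/-- The factor `√(2 - |τ|²)`. -/
def stdScale (τ : ℂ) : ℝ := √(2 - ‖τ‖ ^ 2)

/-- The map `(z, τ) ↦ √(2 - |τ|²) z + τ z̄`. -/
def stdLift (y : C3 × ℂ) : C3 := (stdScale y.2 : ℂ) • y.1 + y.2 • star y.1

lemma stdScale_sq {τ : ℂ} (h : ‖τ‖ < 1) : stdScale τ ^ 2 = 2 - ‖τ‖ ^ 2 := by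
  apply Real.sq_sqrt
  have := norm_nonneg τ
  nlinarith

lemma stdScale_pos {τ : ℂ} (h : ‖τ‖ < 1) : 0 < stdScale τ := by
  apply Real.sqrt_pos.mpr
  have := norm_nonneg τ
  nlinarith

lemma stdLift_ne_zero {y : C3 × ℂ} (hy : y ∈ cone) : stdLift y ≠ 0 := by
  by_cases h : y.2 = 0
  · apply combination_ne_zero hy.1 hy.2
    rw [h, stdScale, norm_zero]
    norm_num
  · rw [stdLift, add_comm]
    have := combination_ne_zero (star_ne_zero.mpr hy.1) (star_isotropic hy.2) h
      (stdScale y.2 : ℂ)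
    rwa [star_star] at this

/-- The phase l / l̄ of τ meets the factor l̄ of z̄, so both summands scale by l and the lift
descends to CP². -/
lemma stdLift_rescale {l : ℂ} (hl : l ≠ 0) (y : C3 × ℂ) :
    stdLift (rescale l y) = l • stdLift y := by
  have h1 : stdScale (l / star l * y.2) = stdScale y.2 := by
    rw [stdScale, norm_mul, norm_div_star hl, one_mul, stdScale]
  have hl' : star l ≠ 0 := star_ne_zero.mpr hl
  rw [stdLift, rescale, h1, stdLift, smul_add, star_smul, smul_smul, smul_smul, smul_smul,
    smul_smul]
  congr 2
  · ring
  · field_simp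

/-- The standard disc bundle as a map into the projective plane. -/
def stdMap (e : NormalBundle) : CP2 :=
  Projectivization.mk ℂ (stdLift (coords e)) (stdLift_ne_zero (hasCoords_coords e).mem_cone)

lemma HasCoords.represents_stdMap {e : NormalBundle} {y : C3 × ℂ} (h : HasCoords e y) :
    Represents (stdLift y) (stdMap e) := by
  obtain ⟨l, hl, e1⟩ := (hasCoords_coords e).exists_rescale h
  rw [e1, stdLift_rescale hl]
  exact (represents_mk (stdLift_ne_zero (hasCoords_coords e).mem_cone)).smul hl

lemma planeNormal_stdLift {y : C3 × ℂ} (h : ‖y.2‖ < 1) :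
    planeNormal (stdLift y) = (2 * (1 - ‖y.2‖ ^ 2)) • planeNormal y.1 := by
  rw [stdLift, planeNormal_combination, Complex.norm_real, Real.norm_of_nonneg
    (stdScale_pos h).le, stdScale_sq h]
  congr 1
  ring

lemma one_sub_norm_sq_pos {τ : ℂ} (h : ‖τ‖ < 1) : 0 < 1 - ‖τ‖ ^ 2 := by
  have := norm_nonneg τ
  nlinarith

lemma HasCoords.stdMap_mem_disc {e : NormalBundle} {y : C3 × ℂ} (h : HasCoords e y)
    (h1 : ‖y.2‖ < 1) : stdMap e ∈ disc y.1 := by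
  rw [h.represents_stdMap.mem_disc h.1 h.isotropic]
  exact ⟨_, by have := one_sub_norm_sq_pos h1; positivity, planeNormal_stdLift h1⟩

lemma stdMap_notMem_RP2 {e : NormalBundle} (he : stdMetric.norm e < 1) : stdMap e ∉ RP2 := by
  have h := hasCoords_coords e
  have h1 : ‖(coords e).2‖ < 1 := he
  rw [h.represents_stdMap.mem_RP2, planeNormal_stdLift h1, smul_eq_zero, not_or]
  exact ⟨by have := one_sub_norm_sq_pos h1; positivity, planeNormal_ne_zero h.1 h.isotropic⟩

lemma stdMap_zero (x : quadric) : stdMap ⟨x, 0⟩ = x.1 := by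
  obtain ⟨z, hz⟩ := exists_represents x.1
  refine (hasCoords_zero hz).represents_stdMap.unique ?_
  have : (stdScale 0 : ℂ) ≠ 0 := by
    have : 0 < stdScale 0 := stdScale_pos (by simp)
    exact_mod_cast this.ne'
  simpa [stdLift] using hz.smul this

lemma injOn_stdMap : Set.InjOn stdMap {e | stdMetric.norm e < 1} := by
  intro e he e' he' hee
  obtain ⟨z, hz⟩ := exists_represents e.1.1
  obtain ⟨τ, h⟩ := exists_hasCoords e hz
  have hτ : ‖τ‖ < 1 := h.stdMetric_norm ▸ he
  have hb : e'.1.1 = e.1.1 := by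
    have h' := hasCoords_coords e'
    refine eq_of_disc_inter hz h.isotropic h'.represents h'.isotropic
      (h.stdMap_mem_disc hτ) ?_
    rw [hee]
    exact h'.stdMap_mem_disc he'
  obtain ⟨τ', h'⟩ := exists_hasCoords e' (z := z) (by rw [hb]; exact hz)
  have hτ' : ‖τ'‖ < 1 := h'.stdMetric_norm ▸ he'
  have r := h.represents_stdMap
  rw [hee] at r
  obtain ⟨l, hl, e1⟩ := r.exists_smul h'.represents_stdMap
  simp only [stdLift, smul_add, smul_smul] at e1
  have hN := normSq_ne_zero hz.1
  have f1 := congrArg (herm z) e1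
  have f2 := congrArg (herm (star z)) e1
  rw [herm_isotropic_combination h.isotropic, herm_isotropic_combination h.isotropic] at f1
  rw [herm_star_isotropic_combination h.isotropic,
    herm_star_isotropic_combination h.isotropic] at f2
  have g1 := mul_right_cancel₀ hN f1
  have g2 := mul_right_cancel₀ hN f2
  have n1 := congrArg (fun c : ℂ => ‖c‖ ^ 2) g1
  have n2 := congrArg (fun c : ℂ => ‖c‖ ^ 2) g2
  simp only [norm_mul, mul_pow, Complex.norm_real, Real.norm_eq_abs, sq_abs, stdScale_sq hτ,
    stdScale_sq hτ'] at n1 n2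
  -- The squared moduli of the coefficients of z and z̄ add up to 2 for both lifts. The coefficient
  -- of z is positive, which then leaves l = 1.
  have hl1 : ‖l‖ ^ 2 = 1 := by linarith
  rw [hl1, one_mul] at n2
  have hs : stdScale τ' = stdScale τ := by rw [stdScale, stdScale, n2]
  have hsne : (stdScale τ : ℂ) ≠ 0 := by exact_mod_cast (stdScale_pos hτ).ne'
  rw [hs] at g1
  have hl2 : l = 1 := by
    have : (l - 1) * (stdScale τ : ℂ) = 0 := by linear_combination -g1
    exact sub_eq_zero.mp ((mul_eq_zero.mp this).resolve_right hsne)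
  rw [hl2, one_mul] at g2
  subst g2
  exact h.ext h'

/-! ### Smoothness of the standard disc bundle and of its inverse -/

lemma contDiffAt_stdScale {y : C3 × ℂ} (h : ‖y.2‖ < 1) :
    ContDiffAt ℝ ∞ (fun x : C3 × ℂ => stdScale x.2) y := by
  refine ContDiffAt.sqrt (contDiffAt_const.sub (contDiffAt_norm_sq contDiffAt_snd)) ?_
  have := one_sub_norm_sq_pos h
  have : 0 < 2 - ‖y.2‖ ^ 2 := by linarith
  exact this.ne'

lemma contDiffAt_stdLift {y : C3 × ℂ} (h : ‖y.2‖ < 1) : ContDiffAt ℝ ∞ stdLift y :=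
  ((contDiffAt_ofReal (contDiffAt_stdScale h)).smul contDiffAt_fst).add
    (contDiffAt_snd.smul (contDiffAt_star_pi contDiffAt_fst))

lemma isLiftAt_stdLift {y : C3 × ℂ} (h : ‖y.2‖ < 1) : IsLiftAt stdMap stdLift y :=
  ⟨contDiffAt_stdLift h, Filter.Eventually.of_forall fun _ _ he => he.represents_stdMap⟩

/-- The larger root `m` of `m² - |w|² m + |w·w|² / 4 = 0`. -/
def invMass (w : C3) : ℝ := (normSq w + √(normSq w ^ 2 - ‖w ⬝ᵥ w‖ ^ 2)) / 2

/-- The coordinate `σ` of `[w] = [z + σ z̄]`. -/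
def invRatio (w : C3) : ℂ := (w ⬝ᵥ w) / (2 * invMass w : ℝ)

/-- Homogeneous coordinates of the point of the standard disc bundle over `[w]`. -/
def invCoords (w : C3) : C3 × ℂ :=
  (w - invRatio w • star w, ((√(2 / (1 + ‖invRatio w‖ ^ 2)) : ℝ) : ℂ) * invRatio w)

/-! ### Recovering (z, τ) from w -/

section Inverse
variable {w : C3}

lemma normSq_sq_sub_pos (hn : planeNormal w ≠ 0) : 0 < normSq w ^ 2 - ‖w ⬝ᵥ w‖ ^ 2 := by
  rw [← four_mul_planeNormal_sq]
  have := planeNormal_dot_pos hn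
  positivity

lemma ne_zero_of_planeNormal (hn : planeNormal w ≠ 0) : w ≠ 0 := by
  rintro rfl
  apply hn
  ext i
  fin_cases i <;> simp [planeNormal]

lemma invMass_pos (hn : planeNormal w ≠ 0) : 0 < invMass w := by
  have h1 := normSq_pos (ne_zero_of_planeNormal hn)
  have h2 := Real.sqrt_nonneg (normSq w ^ 2 - ‖w ⬝ᵥ w‖ ^ 2)
  rw [invMass]
  linarith

/-- If w = z + σz̄ with z isotropic and m = |z|², then |w|² = (1 + |σ|²)m and w·w = 2σm; eliminating
σ gives this equation. The larger root is the one with |σ| < 1. -/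
lemma invMass_root (hn : planeNormal w ≠ 0) :
    invMass w ^ 2 - normSq w * invMass w + ‖w ⬝ᵥ w‖ ^ 2 / 4 = 0 := by
  have h := Real.sq_sqrt (normSq_sq_sub_pos hn).le
  rw [invMass]
  linear_combination h / 4

lemma norm_invRatio_lt (hn : planeNormal w ≠ 0) : ‖invRatio w‖ < 1 := by
  have hm := invMass_pos hn
  have h1 := normSq_pos (ne_zero_of_planeNormal hn)
  have h2 := Real.sqrt_nonneg (normSq w ^ 2 - ‖w ⬝ᵥ w‖ ^ 2)
  have h3 := normSq_sq_sub_pos hn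
  rw [invRatio, norm_div, Complex.norm_real, Real.norm_of_nonneg (by positivity),
    div_lt_one (by positivity)]
  have h4 : ‖w ⬝ᵥ w‖ < normSq w := by
    have := norm_nonneg (w ⬝ᵥ w)
    nlinarith
  rw [invMass]
  linarith

lemma contDiffAt_invCoords (hn : planeNormal w ≠ 0) : ContDiffAt ℝ ∞ invCoords w := by
  have hdot : ContDiffAt ℝ ∞ (fun w : C3 => w ⬝ᵥ w) w := contDiffAt_dot contDiffAt_id contDiffAt_id
  have hN : ContDiffAt ℝ ∞ (fun w : C3 => normSq w) w := contDiffAt_normSq contDiffAt_id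
  have hm : ContDiffAt ℝ ∞ invMass w :=
    (hN.add (ContDiffAt.sqrt ((hN.pow 2).sub (contDiffAt_norm_sq hdot))
      (normSq_sq_sub_pos hn).ne')).div_const 2
  have hr : ContDiffAt ℝ ∞ invRatio w := by
    have h : invRatio = fun w => (w ⬝ᵥ w) * (((2 * invMass w : ℝ) : ℂ))⁻¹ := by
      funext w; rw [invRatio, div_eq_mul_inv]
    rw [h]
    refine hdot.mul ((contDiffAt_ofReal (contDiffAt_const.mul hm)).inv ?_)
    have := invMass_pos hn
    exact_mod_cast (by positivity : 2 * invMass w ≠ 0)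
  refine ContDiffAt.prodMk (contDiffAt_id.sub (hr.smul (contDiffAt_star_pi contDiffAt_id))) ?_
  refine (contDiffAt_ofReal (ContDiffAt.sqrt (contDiffAt_const.div
    (contDiffAt_const.add (contDiffAt_norm_sq hr)) ?_) ?_)).mul hr
  · positivity
  · exact (by positivity : (0 : ℝ) < 2 / (1 + ‖invRatio w‖ ^ 2)).ne'

lemma norm_invCoords_snd_sq : ‖(invCoords w).2‖ ^ 2 =
    2 * ‖invRatio w‖ ^ 2 / (1 + ‖invRatio w‖ ^ 2) := by
  rw [invCoords, norm_mul, Complex.norm_real, mul_pow, Real.norm_eq_abs, sq_abs,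
    Real.sq_sqrt (by positivity)]
  ring

lemma norm_invCoords_snd_lt (hn : planeNormal w ≠ 0) : ‖(invCoords w).2‖ < 1 := by
  have h1 := norm_invRatio_lt hn
  have h2 := one_sub_norm_sq_pos h1
  have h3 : ‖(invCoords w).2‖ ^ 2 < 1 := by
    rw [norm_invCoords_snd_sq, div_lt_one (by positivity)]
    linarith
  nlinarith [norm_nonneg (invCoords w).2]

lemma stdScale_invCoords :
    stdScale (invCoords w).2 = √(2 / (1 + ‖invRatio w‖ ^ 2)) := by
  rw [stdScale, norm_invCoords_snd_sq]
  congr 1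
  have : 1 + ‖invRatio w‖ ^ 2 ≠ 0 := by positivity
  field_simp
  ring

/-- For w = z + σz̄ one has w - σw̄ = (1 - |σ|²) z; adding back σ times the conjugate of w - σw̄
returns a real multiple of w. -/
lemma stdLift_invCoords : stdLift (invCoords w) =
    ((√(2 / (1 + ‖invRatio w‖ ^ 2)) * (1 - ‖invRatio w‖ ^ 2) : ℝ) : ℂ) • w := by
  have h : star (invRatio w) * invRatio w = (‖invRatio w‖ : ℂ) ^ 2 := Complex.conj_mul' _
  rw [stdLift, stdScale_invCoords]
  simp only [invCoords, star_sub, star_smul, star_star]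
  ext i
  simp only [Pi.add_apply, Pi.smul_apply, Pi.sub_apply, Pi.star_apply, smul_eq_mul]
  push_cast
  rw [← h]
  ring

lemma invCoords_isotropic (hn : planeNormal w ≠ 0) :
    (invCoords w).1 ⬝ᵥ (invCoords w).1 = 0 := by
  have hm := invMass_pos hn
  have hmC : (invMass w : ℂ) ≠ 0 := by exact_mod_cast hm.ne'
  have hroot := invMass_root hn
  have hrootC : (invMass w : ℂ) ^ 2 - normSq w * invMass w + (‖w ⬝ᵥ w‖ : ℂ) ^ 2 / 4 = 0 := by
    exact_mod_cast hroot
  have hq : (w ⬝ᵥ w) * star (w ⬝ᵥ w) = (‖w ⬝ᵥ w‖ : ℂ) ^ 2 := Complex.mul_conj' _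
  have e1 : star w ⬝ᵥ w = normSq w := by rw [← herm_self, herm]
  simp only [invCoords, sub_dotProduct, dotProduct_sub, smul_dotProduct, dotProduct_smul,
    dot_star_self, e1, star_dot_star, smul_eq_mul]
  rw [invRatio]
  push_cast
  field_simp
  linear_combination (4 : ℂ) * (w ⬝ᵥ w) * hrootC + (w ⬝ᵥ w) * hq

lemma invCoords_mem_cone (hn : planeNormal w ≠ 0) : invCoords w ∈ cone := by
  refine ⟨fun h0 => ?_, invCoords_isotropic hn⟩
  have h1 := norm_invRatio_lt hn
  have h2 := one_sub_norm_sq_pos h1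
  have h3 : ((√(2 / (1 + ‖invRatio w‖ ^ 2)) * (1 - ‖invRatio w‖ ^ 2) : ℝ) : ℂ) ≠ 0 := by
    have : 0 < √(2 / (1 + ‖invRatio w‖ ^ 2)) := Real.sqrt_pos.mpr (by positivity)
    exact_mod_cast (by positivity : √(2 / (1 + ‖invRatio w‖ ^ 2)) * (1 - ‖invRatio w‖ ^ 2) ≠ 0)
  have h4 := stdLift_invCoords (w := w)
  rw [stdLift, h0, star_zero, smul_zero, smul_zero, add_zero] at h4
  exact smul_ne_zero h3 (ne_zero_of_planeNormal hn) h4.symm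

lemma exists_stdMap_eq {p : CP2} (h : Represents w p) (hn : planeNormal w ≠ 0) :
    ∃ e, stdMetric.norm e < 1 ∧ stdMap e = p ∧ HasCoords e (invCoords w) := by
  obtain ⟨e, he⟩ := exists_hasCoords_of_mem_cone (invCoords_mem_cone hn)
  refine ⟨e, he.stdMetric_norm ▸ norm_invCoords_snd_lt hn, ?_, he⟩
  have h1 := he.represents_stdMap
  have h2 := h1.1
  rw [stdLift_invCoords] at h1 h2
  exact h1.unique (h.smul (left_ne_zero_of_smul h2))

end Inverse

lemma eventually_planeNormal_ne_zero {w : C3} (hn : planeNormal w ≠ 0) :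
    ∀ᶠ v in 𝓝 w, planeNormal v ≠ 0 := by
  have hc : Continuous planeNormal := by
    refine continuous_pi fun i => ?_
    have hm : ∀ j k : Fin 3, Continuous fun w : C3 => (star (w j) * w k).im := fun j k =>
      Complex.continuous_im.comp ((continuous_apply j).star.mul (continuous_apply k))
    fin_cases i
    · exact hm 1 2
    · exact hm 2 0
    · exact hm 0 1
  exact hc.continuousAt.eventually_ne hn

lemma stdMap_image : stdMap '' {e | stdMetric.norm e < 1} = RP2ᶜ := by
  ext p
  constructor
  · rintro ⟨e, he, rfl⟩
    exact stdMap_notMem_RP2 he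
  · intro hp
    obtain ⟨w, hw⟩ := exists_represents p
    obtain ⟨e, he, h1, _⟩ := exists_stdMap_eq hw fun h => hp (hw.mem_RP2.mpr h)
    exact ⟨e, he, h1⟩

/-! ### Derivatives of lifts along the cone -/

/-- Two lifts of the standard disc bundle have the same derivative along the cone, up to a
rescaling. -/
lemma IsLiftAt.exists_scale {y : C3 × ℂ} (hy : y ∈ cone) (hτ : ‖y.2‖ < 1) {G : C3 × ℂ → C3}
    (hG : IsLiftAt stdMap G y) :
    ∃ c : ℂ, c ≠ 0 ∧ G y = c • stdLift y ∧
      ∀ v ∈ coneTangent y, ∃ a : ℂ, fderiv ℝ G y v = c • fderiv ℝ stdLift y v + a • stdLift y := by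
  have hL := contDiffAt_stdLift hτ
  obtain ⟨e, he⟩ := exists_hasCoords_of_mem_cone hy
  have hN : (normSq (stdLift y) : ℂ) ≠ 0 := normSq_ne_zero (stdLift_ne_zero hy)
  -- The ratio of the two lifts, written as a projection coefficient so that it is visibly smooth.
  -- It relates the lifts only on the cone, so derivatives are compared along a curve that stays
  -- there.
  set c : C3 × ℂ → ℂ := fun x => herm (stdLift x) (G x) * (normSq (stdLift x) : ℂ)⁻¹ with hc
  have hcd : ContDiffAt ℝ ∞ c y :=
    (contDiffAt_herm hL hG.1).mul ((contDiffAt_ofReal (contDiffAt_normSq hL)).inv hN)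
  have key : ∀ x ∈ cone, (∀ e, HasCoords e x → Represents (G x) (stdMap e)) →
      c x ≠ 0 ∧ G x = c x • stdLift x := by
    intro x hx hr
    obtain ⟨e, he⟩ := exists_hasCoords_of_mem_cone hx
    obtain ⟨l, hl, h1⟩ := he.represents_stdMap.exists_smul (hr e he)
    have h2 := normSq_ne_zero (stdLift_ne_zero hx)
    have h3 : c x = l := by
      simp only [hc]
      rw [h1, herm_smul_right, herm_self, mul_assoc, mul_inv_cancel₀ h2, mul_one]
    rw [h3]
    exact ⟨hl, h1⟩
  obtain ⟨hc0, hc1⟩ := key y hy hG.2.self_of_nhds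
  refine ⟨c y, hc0, hc1, fun v hv => ?_⟩
  have hv' : y.1 ⬝ᵥ v.1 = 0 := hv
  have hm := normSq_ne_zero hy.1
  -- For y = (z, τ), the first component of y + tv leaves the cone by t²(v·v). Adding κz̄ changes
  -- its square by 2κ(|z|² + t⟨z, v⟩), which fixes κ. It is of order t², so the curve still has
  -- velocity v.
  set den : ℝ → ℂ := fun t => 2 * (normSq y.1 + t * herm y.1 v.1) with hden
  set κ : ℝ → ℂ := fun t => -((t : ℂ) ^ 2 * (v.1 ⬝ᵥ v.1)) / den t with hκ
  set γ : ℝ → C3 × ℂ := fun t => (y.1 + t • v.1 + κ t • star y.1, y.2 + t • v.2) with hγ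
  have hofReal : HasDerivAt (fun t : ℝ => (t : ℂ)) 1 0 := Complex.ofRealCLM.hasDerivAt
  have hdend : HasDerivAt den (2 * herm y.1 v.1) 0 := by
    simpa using ((hofReal.mul_const (herm y.1 v.1)).const_add (normSq y.1 : ℂ)).const_mul 2
  have hden0 : den 0 ≠ 0 := by simpa [hden] using hm
  have hκd : HasDerivAt κ 0 0 := by
    have := ((hofReal.pow 2).mul_const (v.1 ⬝ᵥ v.1)).neg.div hdend hden0
    refine this.congr_deriv ?_
    simp
  have hγd : HasDerivAt γ v 0 := by
    have h1 : HasDerivAt (fun t => y.1 + t • v.1 + κ t • star y.1) v.1 0 := by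
      refine ((hasDerivAt_line y.1 v.1).add (hκd.smul_const (star y.1))).congr_deriv ?_
      simp
    exact h1.prodMk (hasDerivAt_line y.2 v.2)
  have hγ0 : γ 0 = y := by simp [hγ, hκ]
  have hγc : ∀ᶠ t in 𝓝 (0 : ℝ), γ t ∈ cone := by
    have h1 : ∀ᶠ t in 𝓝 (0 : ℝ), den t ≠ 0 := hdend.continuousAt.eventually_ne hden0
    have h2 : ∀ᶠ t in 𝓝 (0 : ℝ), (γ t).1 ≠ 0 := by
      have : ContinuousAt (fun t => (γ t).1) 0 := continuousAt_fst.comp hγd.continuousAt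
      refine this.eventually_ne ?_
      rw [hγ0]; exact hy.1
    filter_upwards [h1, h2] with t ht1 ht2
    refine ⟨ht2, ?_⟩
    have e1 : v.1 ⬝ᵥ y.1 = 0 := by rw [dotProduct_comm]; exact hv'
    have e2 : star y.1 ⬝ᵥ y.1 = normSq y.1 := by rw [dotProduct_comm, dot_star_self]
    have e3 : star y.1 ⬝ᵥ v.1 = herm y.1 v.1 := rfl
    have e4 : v.1 ⬝ᵥ star y.1 = herm y.1 v.1 := by rw [dotProduct_comm]; rfl
    have e5 : κ t * den t = -((t : ℂ) ^ 2 * (v.1 ⬝ᵥ v.1)) := div_mul_cancel₀ _ ht1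
    simp only [hγ, real_smul_eq, add_dotProduct, dotProduct_add, smul_dotProduct,
      dotProduct_smul, hy.2, hv', e1, e2, e3, e4, dot_star_self, star_isotropic hy.2, smul_eq_mul]
    simp only [hden] at e5
    linear_combination e5
  have hGe : ∀ᶠ t in 𝓝 (0 : ℝ), G (γ t) = c (γ t) • stdLift (γ t) := by
    have hG2 := hG.2
    rw [← hγ0] at hG2
    filter_upwards [hγc, hγd.continuousAt.eventually hG2] with t ht1 ht2
    exact (key _ ht1 ht2).2
  have comp : ∀ {F : Type} [NormedAddCommGroup F] [NormedSpace ℝ F] {f : C3 × ℂ → F},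
      ContDiffAt ℝ ∞ f y → HasDerivAt (fun t => f (γ t)) (fderiv ℝ f y v) 0 := by
    intro F _ _ f hf
    have h1 : HasFDerivAt f (fderiv ℝ f y) (γ 0) := by
      rw [hγ0]; exact (hf.differentiableAt (by simp)).hasFDerivAt
    exact h1.comp_hasDerivAt 0 hγd
  have d1 := comp hG.1
  have d2 := ((comp hcd).smul (comp hL)).congr_of_eventuallyEq hGe
  refine ⟨fderiv ℝ c y v, ?_⟩
  rw [d1.unique d2, hγ0]

lemma hasDerivAt_norm_sq_line (τ T : ℂ) :
    HasDerivAt (fun t : ℝ => ‖τ + t • T‖ ^ 2) (2 * (star τ * T).re) 0 := by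
  have h : (fun t : ℝ => ‖τ + t • T‖ ^ 2) =
      fun t : ℝ => ‖τ‖ ^ 2 + 2 * (star τ * T).re * t + ‖T‖ ^ 2 * t ^ 2 := by
    funext t
    simp only [Complex.sq_norm, Complex.normSq_apply]
    simp
    ring
  rw [h]
  refine ((((hasDerivAt_id (0 : ℝ)).const_mul (2 * (star τ * T).re)).const_add (‖τ‖ ^ 2)).add
    ((hasDerivAt_pow 2 (0 : ℝ)).const_mul (‖T‖ ^ 2))).congr_deriv ?_
  simp

lemma fderiv_stdLift {y : C3 × ℂ} (hτ : ‖y.2‖ < 1) (v : C3 × ℂ) :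
    fderiv ℝ stdLift y v = ((-(star y.2 * v.2).re / stdScale y.2 : ℝ) : ℂ) • y.1
      + (stdScale y.2 : ℂ) • v.1 + (v.2 • star y.1 + y.2 • star v.1) := by
  apply fderiv_eq_of_hasDerivAt_line ((contDiffAt_stdLift hτ).differentiableAt (by simp))
  have hs := stdScale_pos hτ
  have hs2 := stdScale_sq hτ
  have d1 : HasDerivAt (fun t : ℝ => stdScale (y.2 + t • v.2))
      (-(star y.2 * v.2).re / stdScale y.2) 0 := by
    refine (((hasDerivAt_norm_sq_line y.2 v.2).const_sub 2).sqrt ?_).congr_deriv ?_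
    · simp only [zero_smul, add_zero]
      rw [← hs2]; positivity
    · simp only [zero_smul, add_zero]
      rw [stdScale, neg_div, neg_div, mul_div_mul_left _ _ two_ne_zero]
  have d2 : HasDerivAt (fun t : ℝ => ((stdScale (y.2 + t • v.2) : ℝ) : ℂ))
      ((-(star y.2 * v.2).re / stdScale y.2 : ℝ) : ℂ) 0 :=
    Complex.ofRealCLM.hasFDerivAt.comp_hasDerivAt 0 d1
  have d3 : HasDerivAt (fun t : ℝ => star (y.1 + t • v.1)) (star v.1) 0 := by
    have h : (fun t : ℝ => star (y.1 + t • v.1)) = fun t : ℝ => star y.1 + t • star v.1 := by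
      funext t; ext i; simp
    rw [h]; exact hasDerivAt_line _ _
  refine ((d2.smul (hasDerivAt_line y.1 v.1)).add
    ((hasDerivAt_line y.2 v.2).smul d3)).congr_deriv ?_
  simp only [zero_smul, add_zero]
  abel

/-! ### The gradient condition -/

lemma contDiffAt_potential {w : C3} (hw : w ≠ 0) (hww : w ⬝ᵥ w ≠ 0) :
    ContDiffAt ℝ ∞ potential w := by
  have hN := (normSq_pos hw).ne'
  have hq : ‖w ⬝ᵥ w‖ ≠ 0 := norm_ne_zero_iff.mpr hww
  refine (ContDiffAt.log ((contDiffAt_norm_sq (contDiffAt_dot contDiffAt_id contDiffAt_id)).div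
    ((contDiffAt_normSq contDiffAt_id).pow 2) ?_) ?_).neg
  · exact pow_ne_zero 2 hN
  · exact div_ne_zero (pow_ne_zero 2 hq) (pow_ne_zero 2 hN)

lemma fderiv_potential {w : C3} (hw : w ≠ 0) (hww : w ⬝ᵥ w ≠ 0) (u : C3) :
    fderiv ℝ potential w u = 4 * (herm w u / normSq w - (w ⬝ᵥ u) / (w ⬝ᵥ w)).re := by
  apply fderiv_eq_of_hasDerivAt_line ((contDiffAt_potential hw hww).differentiableAt (by simp))
  have hN := (normSq_pos hw).ne'
  have hq : ‖w ⬝ᵥ w‖ ≠ 0 := norm_ne_zero_iff.mpr hww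
  have d1 : HasDerivAt (fun t : ℝ => (w + t • u) ⬝ᵥ (w + t • u)) (2 * (w ⬝ᵥ u)) 0 := by
    have h : (fun t : ℝ => (w + t • u) ⬝ᵥ (w + t • u)) =
        fun t : ℝ => w ⬝ᵥ w + (t : ℂ) * (2 * (w ⬝ᵥ u)) + (t : ℂ) ^ 2 * (u ⬝ᵥ u) := by
      funext t
      rw [real_smul_eq, add_dotProduct, dotProduct_add, dotProduct_add, dotProduct_smul,
        smul_dotProduct, smul_dotProduct, dotProduct_smul, dotProduct_comm u w]
      simp only [smul_eq_mul]
      ring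
    have hofReal : HasDerivAt (fun t : ℝ => (t : ℂ)) 1 0 := Complex.ofRealCLM.hasDerivAt
    rw [h]
    refine (((hofReal.mul_const (2 * (w ⬝ᵥ u))).const_add (w ⬝ᵥ w)).add
      ((hofReal.pow 2).mul_const (u ⬝ᵥ u))).congr_deriv ?_
    simp
  have d2 : HasDerivAt (fun t : ℝ => ‖(w + t • u) ⬝ᵥ (w + t • u)‖ ^ 2)
      (4 * (star (w ⬝ᵥ w) * (w ⬝ᵥ u)).re) 0 := by
    simp only [Complex.sq_norm, Complex.normSq_apply]
    refine (((hasDerivAt_re d1).mul (hasDerivAt_re d1)).add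
      ((hasDerivAt_im d1).mul (hasDerivAt_im d1))).congr_deriv ?_
    simp
    ring
  have d3 : HasDerivAt (fun t : ℝ => normSq (w + t • u) ^ 2)
      (2 * normSq w * (2 * (herm w u).re)) 0 := by
    simpa using (hasDerivAt_normSq_line w u).fun_pow 2
  have d4 := ((d2.div d3 (by simpa using hN)).log (by simpa using ⟨hww, hN⟩)).neg
  refine d4.congr_deriv ?_
  have e1 : ((w ⬝ᵥ u) / (w ⬝ᵥ w)).re = (star (w ⬝ᵥ w) * (w ⬝ᵥ u)).re / ‖w ⬝ᵥ w‖ ^ 2 := by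
    rw [Complex.sq_norm, Complex.div_re]
    simp
    ring
  rw [Complex.sub_re, Complex.div_ofReal_re, e1]
  simp only [zero_smul, add_zero, Pi.div_apply]
  field_simp
  ring

lemma fsMetric_change {w : C3} (hw : w ≠ 0) {l : ℂ} (hl : l ≠ 0) (u v : C3) (a : ℂ) :
    fsMetric (l • w) (l • u + a • w) (l • v) = fsMetric w u v := by
  have := fsHerm_change hw hl u v a 0
  rw [zero_smul, add_zero] at this
  rw [fsMetric, fsMetric, this]

lemma fderiv_potential_smul {w : C3} (hw : w ≠ 0) (hww : w ⬝ᵥ w ≠ 0) {l : ℂ} (hl : l ≠ 0)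
    (u : C3) : fderiv ℝ potential (l • w) (l • u) = fderiv ℝ potential w u := by
  have h1 : (l • w) ⬝ᵥ (l • w) ≠ 0 := by
    rw [smul_dotProduct, dotProduct_smul]
    exact mul_ne_zero hl (mul_ne_zero hl hww)
  have hl' : star l ≠ 0 := star_ne_zero.mpr hl
  have hN := normSq_ne_zero hw
  have hN' : (normSq (l • w) : ℂ) = star l * l * normSq w := by
    rw [← herm_self, herm_smul_left, herm_smul_right, herm_self]; ring
  rw [fderiv_potential (smul_ne_zero hl hw) h1, fderiv_potential hw hww, hN']
  simp only [herm_smul_left, herm_smul_right, smul_dotProduct, dotProduct_smul, smul_eq_mul]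
  congr 2
  field_simp

lemma stdLift_dot_self {y : C3 × ℂ} (hy : y ∈ cone) :
    stdLift y ⬝ᵥ stdLift y = 2 * stdScale y.2 * y.2 * normSq y.1 := by
  have e2 : star y.1 ⬝ᵥ y.1 = normSq y.1 := by rw [dotProduct_comm, dot_star_self]
  simp only [stdLift, add_dotProduct, dotProduct_add, smul_dotProduct, dotProduct_smul, hy.2,
    dot_star_self, e2, star_isotropic hy.2, smul_eq_mul]
  ring

lemma normSq_stdLift {y : C3 × ℂ} (hy : y ∈ cone) (hτ : ‖y.2‖ < 1) :
    normSq (stdLift y) = 2 * normSq y.1 := by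
  have hs2 := stdScale_sq hτ
  have h : (normSq (stdLift y) : ℂ) = ((2 * normSq y.1 : ℝ) : ℂ) := by
    have h1 : star y.2 * y.2 = (‖y.2‖ : ℂ) ^ 2 := Complex.conj_mul' _
    have h2 : (stdScale y.2 : ℂ) ^ 2 = 2 - (‖y.2‖ : ℂ) ^ 2 := by exact_mod_cast hs2
    rw [← herm_self]
    conv_lhs => rw [stdLift, herm_add_left, herm_smul_left, herm_smul_left,
      herm_isotropic_combination hy.2, herm_star_isotropic_combination hy.2]
    push_cast
    have h3 : star (stdScale y.2 : ℂ) = stdScale y.2 := Complex.conj_ofReal _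
    rw [h3]
    linear_combination (normSq y.1 : ℂ) * h1 + (normSq y.1 : ℂ) * h2
  exact_mod_cast h

/-- The radial derivative of the lift is Hermitian orthogonal to the lift, so the metric reduces to
the flat product over |w|². The factor is negative because the potential decreases away from the
quadric. -/
lemma stdLift_gradient {y : C3 × ℂ} (hy : y ∈ cone) (hτ : ‖y.2‖ < 1) (hτ0 : y.2 ≠ 0) (u : C3) :
    fsMetric (stdLift y) (fderiv ℝ stdLift y (0, y.2)) u =
      -(‖y.2‖ ^ 2 / (2 * Real.pi * (1 - ‖y.2‖ ^ 2))) * fderiv ℝ potential (stdLift y) u := by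
  have hs := stdScale_pos hτ
  have hs2 := stdScale_sq hτ
  have hsC : (stdScale y.2 : ℂ) ≠ 0 := by exact_mod_cast hs.ne'
  have hm := normSq_pos hy.1
  have hmC := normSq_ne_zero hy.1
  have hq : stdLift y ⬝ᵥ stdLift y ≠ 0 := by
    rw [stdLift_dot_self hy]
    exact mul_ne_zero (mul_ne_zero (mul_ne_zero two_ne_zero hsC) hτ0) hmC
  have hr := one_sub_norm_sq_pos hτ
  have h1 : star y.2 * y.2 = (‖y.2‖ : ℂ) ^ 2 := Complex.conj_mul' _
  have h2 : (stdScale y.2 : ℂ) ^ 2 = 2 - (‖y.2‖ : ℂ) ^ 2 := by exact_mod_cast hs2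
  have hre : (star y.2 * y.2).re = ‖y.2‖ ^ 2 := by
    rw [h1]; exact_mod_cast Complex.ofReal_re _
  have hD : fderiv ℝ stdLift y (0, y.2) =
      ((-‖y.2‖ ^ 2 / stdScale y.2 : ℝ) : ℂ) • y.1 + y.2 • star y.1 := by
    rw [fderiv_stdLift hτ]
    simp only [hre]
    simp
  have hDw : herm (fderiv ℝ stdLift y (0, y.2)) (stdLift y) = 0 := by
    have h3 : ∀ x : ℝ, star (x : ℂ) = x := Complex.conj_ofReal
    rw [hD, herm_add_left, herm_smul_left, herm_smul_left, stdLift,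
      herm_isotropic_combination hy.2, herm_star_isotropic_combination hy.2, h3]
    push_cast
    field_simp
    linear_combination (normSq y.1 : ℂ) * h1
  have hDu : herm (fderiv ℝ stdLift y (0, y.2)) u =
      -(‖y.2‖ : ℂ) ^ 2 / stdScale y.2 * herm y.1 u + star y.2 * herm (star y.1) u := by
    have h3 : ∀ x : ℝ, star (x : ℂ) = x := Complex.conj_ofReal
    rw [hD, herm_add_left, herm_smul_left, herm_smul_left, h3]
    push_cast; rfl
  have hwu : herm (stdLift y) u = stdScale y.2 * herm y.1 u + star y.2 * herm (star y.1) u := by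
    have h3 : ∀ x : ℝ, star (x : ℂ) = x := Complex.conj_ofReal
    rw [stdLift, herm_add_left, herm_smul_left, herm_smul_left, h3]
  have hdu : stdLift y ⬝ᵥ u = stdScale y.2 * herm (star y.1) u + y.2 * herm y.1 u := by
    rw [stdLift, add_dotProduct, smul_dotProduct, smul_dotProduct, herm_star_left]
    rfl
  have hrC : (1 - (‖y.2‖ : ℂ) ^ 2) ≠ 0 := by exact_mod_cast hr.ne'
  rw [fderiv_potential (stdLift_ne_zero hy) hq, fsMetric, fsHerm, hDw, zero_mul, sub_zero,
    normSq_stdLift hy hτ, hDu, hwu, hdu, stdLift_dot_self hy]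
  have key : (-(‖y.2‖ : ℂ) ^ 2 / stdScale y.2 * herm y.1 u + star y.2 * herm (star y.1) u)
        * ((2 * normSq y.1 : ℝ) : ℂ) / ((2 * normSq y.1 : ℝ) : ℂ) ^ 2 =
      ((-‖y.2‖ ^ 2 / (1 - ‖y.2‖ ^ 2) : ℝ) : ℂ) *
      ((stdScale y.2 * herm y.1 u + star y.2 * herm (star y.1) u) / ((2 * normSq y.1 : ℝ) : ℂ) -
        (stdScale y.2 * herm (star y.1) u + y.2 * herm y.1 u) /
          (2 * stdScale y.2 * y.2 * normSq y.1)) := by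
    push_cast
    field_simp
    linear_combination (‖y.2‖ : ℂ) ^ 2 * y.2 * herm y.1 u * h2
      + (stdScale y.2 : ℂ) * herm (star y.1) u * h1
  rw [key, Complex.re_ofReal_mul]
  have hpi := Real.pi_ne_zero
  field_simp
  ring

/-! ### The symplectic form of the standard disc bundle -/

/-- Leibniz: d(r²α) = r² dα + d(r²) ∧ α, where dα = -ω and r = |τ|. -/
lemma standardForm_std {y : C3 × ℂ} (hy : y.1 ≠ 0) (hτ : y.2 ≠ 0) (v w : C3 × ℂ) :
    standardForm stdMetric stdConnection y v w = (1 - ‖y.2‖ ^ 2) * fsForm y.1 v.1 w.1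
      + 2 * (star y.2 * v.2).re * stdConnectionForm y ![w]
      - 2 * (star y.2 * w.2).re * stdConnectionForm y ![v] := by
  have hf : (fun y' : C3 × ℂ => stdMetric.radius y' ^ 2 • stdConnection.form y') =
      fun y' => ‖y'.2‖ ^ 2 • stdConnectionForm y' := by
    funext y'
    simp [HermitianMetric.radius, stdMetric, stdConnection]
  have hn : DifferentiableAt ℝ (fun x : C3 × ℂ => ‖x.2‖ ^ 2) y :=
    (contDiffAt_norm_sq (n := 1) contDiffAt_snd).differentiableAt one_ne_zero
  have hα : DifferentiableAt ℝ stdConnectionForm y :=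
    (contDiffAt_stdConnectionForm hy hτ).differentiableAt (by simp)
  have hd : ∀ v w : C3 × ℂ,
      fderiv ℝ (fun x : C3 × ℂ => (‖x.2‖ ^ 2 • stdConnectionForm x) ![w]) y v =
      ‖y.2‖ ^ 2 * fderiv ℝ (fun x => stdConnectionForm x ![w]) y v
        + 2 * (star y.2 * v.2).re * stdConnectionForm y ![w] := by
    intro v w
    change fderiv ℝ (fun x : C3 × ℂ => ‖x.2‖ ^ 2 * stdConnectionForm x ![w]) y v = _
    rw [fderiv_fun_mul hn (differentiableAt_stdConnectionForm_apply hy hτ w)]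
    have : fderiv ℝ (fun x : C3 × ℂ => ‖x.2‖ ^ 2) y v = 2 * (star y.2 * v.2).re :=
      fderiv_eq_of_hasDerivAt_line hn (hasDerivAt_norm_sq_line y.2 v.2)
    simp only [add_apply, smul_apply, smul_eq_mul, this]
    ring
  have hext := extDeriv_stdConnectionForm hy hτ v w
  rw [extDeriv_apply_two hα] at hext
  have hs : DifferentiableAt ℝ (fun x : C3 × ℂ => ‖x.2‖ ^ 2 • stdConnectionForm x) y :=
    hn.smul hα
  rw [standardForm, hf, extDeriv_apply_two hs, hd, hd]
  linear_combination ‖y.2‖ ^ 2 * hext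

lemma stdLift_symplectic {y : C3 × ℂ} (hy : y ∈ cone) (hτ : ‖y.2‖ < 1) (hτ0 : y.2 ≠ 0)
    {v w : C3 × ℂ} (hv : v ∈ coneTangent y) (hw : w ∈ coneTangent y) :
    fsForm (stdLift y) (fderiv ℝ stdLift y v) (fderiv ℝ stdLift y w) =
      standardForm stdMetric stdConnection y v w := by
  have hs := stdScale_pos hτ
  have hs2 := stdScale_sq hτ
  have hm := normSq_pos hy.1
  have hm' := hm.ne'
  have hpi := Real.pi_ne_zero
  have hr : (0 : ℝ) < ‖y.2‖ ^ 2 := by have := norm_pos_iff.mpr hτ0; positivity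
  have hzv : y.1 ⬝ᵥ v.1 = 0 := hv
  have hzw : y.1 ⬝ᵥ w.1 = 0 := hw
  have hvz : v.1 ⬝ᵥ y.1 = 0 := by rw [dotProduct_comm]; exact hv
  have h3 : ∀ x : ℝ, star (x : ℂ) = x := Complex.conj_ofReal
  have hnorm : ‖y.2‖ ^ 2 = y.2.re ^ 2 + y.2.im ^ 2 := by
    rw [Complex.sq_norm, Complex.normSq_apply]; ring
  have hdiv : ∀ T : ℂ, (T / y.2).im = (star y.2 * T).im / ‖y.2‖ ^ 2 := by
    intro T
    rw [Complex.sq_norm, Complex.div_im]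
    simp
    ring
  rw [fsForm_eq, standardForm_std hy.1 hτ0, stdConnectionForm_apply, stdConnectionForm_apply,
    fsForm_eq, normSq_stdLift hy hτ, fderiv_stdLift hτ, fderiv_stdLift hτ, hdiv, hdiv]
  have hGD : ∀ d : ℝ, ∀ x : C3 × ℂ, y.1 ⬝ᵥ x.1 = 0 →
      herm (stdLift y) ((d : ℂ) • y.1 + (stdScale y.2 : ℂ) • x.1
        + (x.2 • star y.1 + y.2 • star x.1)) =
      stdScale y.2 * (d * normSq y.1 + stdScale y.2 * herm y.1 x.1)
        + star y.2 * (x.2 * normSq y.1 + y.2 * star (herm y.1 x.1)) := by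
    intro d x hx
    simp only [stdLift, herm_add_left, herm_add_right, herm_smul_left, herm_smul_right, h3]
    simp only [herm_star_star]
    simp only [herm_star_left, herm_star_right, hx, hy.2, herm_self,
      star_zero, mul_zero, add_zero, zero_add, star_herm]
    ring
  have hDD : ∀ d d' : ℝ,
      herm ((d : ℂ) • y.1 + (stdScale y.2 : ℂ) • v.1 + (v.2 • star y.1 + y.2 • star v.1))
        ((d' : ℂ) • y.1 + (stdScale y.2 : ℂ) • w.1 + (w.2 • star y.1 + y.2 • star w.1)) =
      d * (d' * normSq y.1 + stdScale y.2 * herm y.1 w.1)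
        + stdScale y.2 * (d' * star (herm y.1 v.1) + stdScale y.2 * herm v.1 w.1
          + y.2 * star (v.1 ⬝ᵥ w.1))
        + star v.2 * (w.2 * normSq y.1 + y.2 * star (herm y.1 w.1))
        + star y.2 * (stdScale y.2 * (v.1 ⬝ᵥ w.1) + w.2 * herm y.1 v.1
          + y.2 * star (herm v.1 w.1)) := by
    intro d d'
    simp only [herm_add_left, herm_add_right, herm_smul_left, herm_smul_right, h3]
    simp only [herm_star_star]
    simp only [herm_star_left, herm_star_right, hzw, hvz, hy.2, herm_self,
      star_zero, mul_zero, add_zero, zero_add, star_herm]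
    ring
  rw [hGD _ v hzv, hGD _ w hzw, hDD]
  set a := herm y.1 v.1
  set b := herm y.1 w.1
  set h := herm v.1 w.1
  set c := v.1 ⬝ᵥ w.1
  set m := normSq y.1
  set s := stdScale y.2
  set P := (star y.2 * v.2).re with hP
  set Q := (star y.2 * v.2).im with hQ
  set P' := (star y.2 * w.2).re with hP'
  set Q' := (star y.2 * w.2).im with hQ'
  have hQ0 : (star y.2 * v.2).im = Q := rfl
  have hQ0' : (star y.2 * w.2).im = Q' := rfl
  simp only [Complex.star_def, Complex.mul_re, Complex.mul_im, Complex.conj_re,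
    Complex.conj_im] at hP hQ hP' hQ'
  -- The fibre components enter only through τ̄v₂ = P + iQ and τ̄w₂ = P' + iQ'.
  have hI : ((star v.2 * w.2).im) * ‖y.2‖ ^ 2 = P * Q' - Q * P' := by
    rw [hP, hQ, hP', hQ', hnorm]; simp; ring
  have hds : s * (-P / s) = -P := by field_simp
  have hds' : s * (-P' / s) = -P' := by field_simp
  have r1 : ∀ (d : ℝ) (x : ℂ) (T : ℂ), s * d = -(star y.2 * T).re →
      (s * (d * m + s * x) + star y.2 * (T * m + y.2 * star x) : ℂ).re = 2 * x.re ∧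
      (s * (d * m + s * x) + star y.2 * (T * m + y.2 * star x) : ℂ).im =
        (2 - 2 * ‖y.2‖ ^ 2) * x.im + (star y.2 * T).im * m := by
    intro d x T hd
    rw [hnorm] at hs2 ⊢
    simp only [Complex.star_def, Complex.mul_re, Complex.mul_im, Complex.conj_re,
      Complex.conj_im, Complex.add_re, Complex.add_im, Complex.ofReal_re,
      Complex.ofReal_im] at hd ⊢
    constructor
    · linear_combination m * hd + x.re * hs2
    · linear_combination x.im * hs2
  obtain ⟨ra, ia⟩ := r1 _ a v.2 hds
  obtain ⟨rb, ib⟩ := r1 _ b w.2 hds'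
  rw [ra, ia, rb, ib]
  -- The two terms in c are conjugate to each other, so c drops out of the imaginary part.
  have r2 : ∀ d d' : ℝ, s * d = -P → s * d' = -P' →
      (d * (d' * m + s * b) + s * (d' * star a + s * h + y.2 * star c)
        + star v.2 * (w.2 * m + y.2 * star b)
        + star y.2 * (s * c + w.2 * a + y.2 * star h) : ℂ).im =
      -P * b.im + P' * a.im + (2 - 2 * ‖y.2‖ ^ 2) * h.im + m * (star v.2 * w.2).im
        - (P * b.im + Q * b.re) + (P' * a.im + Q' * a.re) := by
    intro d d' hd hd'
    rw [hnorm] at hs2 ⊢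
    rw [hP, hP', hQ, hQ']
    rw [hP] at hd
    rw [hP'] at hd'
    simp only [Complex.star_def, Complex.mul_re, Complex.mul_im, Complex.conj_re,
      Complex.conj_im, Complex.add_re, Complex.add_im, Complex.ofReal_re,
      Complex.ofReal_im]
    linear_combination b.im * hd - a.im * hd' + h.im * hs2
  rw [r2 _ _ hds hds', hQ0, hQ0']
  have hI2 : (star v.2 * w.2).im = (P * Q' - Q * P') / ‖y.2‖ ^ 2 := by
    rw [eq_div_iff hr.ne']; exact hI
  rw [hI2]
  have hr' := hr.ne'
  set r := ‖y.2‖ ^ 2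
  field_simp
  ring

/-- The standard model of Biran's disc bundle of the quadric. -/
def stdDiscBundle : BiranDiscBundle where
  metric := stdMetric
  connection := stdConnection
  toFun := stdMap
  zero_section := stdMap_zero
  injOn := injOn_stdMap
  image_eq := stdMap_image
  smooth _ _ he h := ⟨stdLift, isLiftAt_stdLift (h.stdMetric_norm ▸ he)⟩
  smooth_inv w₀ p₀ h₀ hp₀ := by
    have hn : planeNormal w₀ ≠ 0 := fun h => hp₀ (h₀.mem_RP2.mpr h)
    refine ⟨invCoords, contDiffAt_invCoords hn, ?_⟩
    filter_upwards [eventually_planeNormal_ne_zero hn] with w hw p hp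
    exact exists_stdMap_eq hp hw
  -- An arbitrary lift differs from `stdLift` by a factor and, in its derivatives, by multiples of
  -- the position vector; the Fubini–Study form ignores both.
  symplectic e y G he h hτ0 hG v hv w hw := by
    have hτ : ‖y.2‖ < 1 := h.stdMetric_norm ▸ he
    obtain ⟨c, hc, h1, h2⟩ := hG.exists_scale h.mem_cone hτ
    obtain ⟨a, ha⟩ := h2 v hv
    obtain ⟨b, hb⟩ := h2 w hw
    rw [← stdLift_symplectic h.mem_cone hτ hτ0 hv hw, h1, ha, hb, fsForm, fsForm,
      fsHerm_change (stdLift_ne_zero h.mem_cone) hc]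
  gradient e y G he h hτ0 hG := by
    have hτ : ‖y.2‖ < 1 := h.stdMetric_norm ▸ he
    obtain ⟨c, hc, h1, h2⟩ := hG.exists_scale h.mem_cone hτ
    obtain ⟨a, ha⟩ := h2 (0, y.2) (dotProduct_zero _)
    refine ⟨-(‖y.2‖ ^ 2 / (2 * Real.pi * (1 - ‖y.2‖ ^ 2))), fun u => ?_⟩
    have hu : u = c • c⁻¹ • u := by rw [smul_smul, mul_inv_cancel₀ hc, one_smul]
    have hL := stdLift_ne_zero h.mem_cone
    have hq : stdLift y ⬝ᵥ stdLift y ≠ 0 := by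
      have hs : (stdScale y.2 : ℂ) ≠ 0 := by exact_mod_cast (stdScale_pos hτ).ne'
      rw [stdLift_dot_self h.mem_cone]
      exact mul_ne_zero (mul_ne_zero (mul_ne_zero two_ne_zero hs) hτ0) (normSq_ne_zero h.1)
    rw [hu, h1, ha, fsMetric_change hL hc, fderiv_potential_smul hL hq hc,
      stdLift_gradient h.mem_cone hτ hτ0]

end BiranQuadric

end

theorem mainTheorem4 :
    Nonempty BiranQuadric.BiranDiscBundle ∧
    ∀ a b c : ℝ, ¬(a = 0 ∧ b = 0 ∧ c = 0) →
      ∃ x : BiranQuadric.CP2,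
        BiranQuadric.conj x ≠ x ∧
        BiranQuadric.realLine a b c ∩ BiranQuadric.quadric = {x, BiranQuadric.conj x} ∧
        BiranQuadric.realLine a b c \ BiranQuadric.RP2 =
          BiranQuadric.side a b c x ∪ BiranQuadric.side a b c (BiranQuadric.conj x) ∧
        Disjoint (BiranQuadric.side a b c x)
          (BiranQuadric.side a b c (BiranQuadric.conj x)) ∧
        BiranQuadric.conj '' BiranQuadric.side a b c x =
          BiranQuadric.side a b c (BiranQuadric.conj x) ∧
        BiranQuadric.IsDisc (BiranQuadric.side a b c x)
          (BiranQuadric.realLine a b c ∩ BiranQuadric.RP2) 1 ∧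
        BiranQuadric.IsDisc (BiranQuadric.side a b c (BiranQuadric.conj x))
          (BiranQuadric.realLine a b c ∩ BiranQuadric.RP2) 1 ∧
        ∀ B : BiranQuadric.BiranDiscBundle,
          B.fibre x = BiranQuadric.side a b c x ∧
          B.fibre (BiranQuadric.conj x) =
            BiranQuadric.side a b c (BiranQuadric.conj x) := by
  refine ⟨⟨BiranQuadric.stdDiscBundle⟩, fun a b c h0 => ?_⟩
  obtain ⟨z, hz⟩ := BiranQuadric.exists_onLine a b c h0
  obtain ⟨x, hx⟩ : ∃ x, BiranQuadric.Represents z x :=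
    ⟨_, BiranQuadric.represents_mk hz.ne_zero⟩
  refine ⟨x, hz.conj_ne hx, hz.inter_quadric hx, ?_⟩
  rw [hz.side_eq hx, hz.star.side_eq hx.conj]
  exact ⟨hz.diff_eq, hz.disc_ne, BiranQuadric.conj_image_disc z, hz.isDisc, hz.star.isDisc,
    fun B => ⟨B.fibre_eq hx hz.isotropic, B.fibre_eq hx.conj hz.star.isotropic⟩⟩
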